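/- **Bundle of Arrays hash table (BOA).** Work in the external-memory model: blocks of $B$ cells, a memory of $M\ge 3B$ cells; a cell holds one fingerprint-value pair or $\lfloor\log_\lambda N\rfloor$ characters (symbols of an alphabet of size $\lambda$); the cost of an operation is the number of block transfers (IOs). Let $2\le\lambda\le N$ be the growth factor. Fingerprints are strings of $L$ characters. A BOA buffers pairs in memory; a full buffer of $B$ pairs is sorted and becomes a run on level $1$. Every run on level $\ell\ge1$ is an array of $B\lambda^{\ell-1}$ pairs sorted by fingerprint. When $\lambda$ runs are present on a level they are merged, by $(\lfloor M/B\rfloor-1)$-way merging, into one run on the next level. Level $\ell$ has a routing filter, an array of $\lambda^{h_\ell}$ characters that maps each prefix of $h_\ell$ characters to the latest run of the level containing a fingerprint with that prefix; each pair in a run has a previous field that names the previous run of the level containing a fingerprint with the same prefix, if there is one. The routing table ratio $\beta=\lambda^{h_\ell}/(B\lambda^{\ell-1})$ is the same for all levels. A run on level $\ell$ is stored in $\lambda^{\ell-1}$ buckets of equal fingerprint range; each bucket is given $F$ cells, where $F$ is the number of pairs in the fullest one, as long as $F\le aB$ (otherwise the run is stored as a plain sorted array). A query reads, on each level, the entry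 of the routing filter for the prefix of the fingerprint and then follows the chain of runs given by the previous fields, fetching from each run the bucket of the fingerprint (or the whole run, if it is a plain array). **Lemma.** For every $c>0$ there are a layout constant $a\in\mathbb N$ and a constant $C>0$, depending only on $c$, such that the following holds for every BOA with growth factor $\lambda$ and routing table ratio $\beta$ for which $3B\le M$, $2\le\lambda\le N$, $B\ge c\log N$ and $\lambda^L\ge cN^2$. 1. Any sequence of $n\le N$ insertions into the empty BOA costs at most $n\cdot\frac{C}{B}\left(\beta+\log_{M/B}N+\log_\lambda N\right)$ IOs in total. That is, the amortized insertion cost is $O\left(\frac1B\left(\beta+\log_{M/B}N+\log_\lambda N\right)\right)$, in the worst case over the fingerprints. 2. Suppose that keys are hashed to fingerprints by a $k$-wise independent hash function with uniformly distributed values, where $k\ge2$ and $k\ge c\log N$. Then, after the insertion of at most $N$ distinct keys, a query for any fixed key, stored or not, costs in expectation at most $C\left(1+\frac{\lambda}{\beta}\right)\log_\lambda N$ IOs. -/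

import Mathlib

/-! Bundle of Arrays hash table (BOA) in the external-memory model.

All lengths on disk are measured in cells.  One cell holds one fingerprint-value pair (with its
previous field); a block has `B` cells, memory has room for `M` cells.  A cell has at least
`log N` bits, so it can alternatively hold `⌊log_lam N⌋` characters, a character being a symbol of
an alphabet of size `lam`.  Every access to the disk is an access to a contiguous segment, and it
is charged the number of blocks that the segment meets.  Computation in memory is free.

Every operation below returns its result together with the number of block transfers it makes. -/

namespace BOA

/-- The parameters of a BOA.  Levels are numbered from `0` (so a run on level `l` has
`B * lam ^ l` entries), and fingerprints are strings of `len` characters. -/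
structure Params where
  /-- block size -/
  B : ℕ
  /-- memory size -/
  M : ℕ
  /-- number of entries that the table is set up for -/
  N : ℕ
  /-- growth factor -/
  lam : ℕ
  /-- number of characters of a fingerprint -/
  len : ℕ
  /-- the routing filter of level `l` is indexed by prefixes of `h l` characters -/
  h : ℕ → ℕ
  /-- a run is stored in equal-sized buckets as long as these need at most `slack * B` cells -/
  slack : ℕ

/-- A fingerprint, that is, a string of `len` characters, as a number in base `lam`. -/
abbrev Fingerprint (p : Params) : Type := Fin (p.lam ^ p.len)

/-- `β` is the routing table ratio: on each level, the number of buckets of the routing filter is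
`β` times the number of entries of a run. -/
def IsRoutingTableRatio (p : Params) (β : ℝ) : Prop :=
  ∀ l : ℕ, (p.lam : ℝ) ^ p.h l = β * ((p.B : ℝ) * (p.lam : ℝ) ^ l)

/-! ### Block transfers -/

/-- The number of blocks of size `b` that meet the segment of `n` cells from cell `start` on. -/
def transfers (b start n : ℕ) : ℕ :=
  if n = 0 then 0 else (start + n - 1) / b - start / b + 1

/-- Transfers made by one sequential scan (reading or writing) of the routing filter of
level `l`, an array of `lam ^ h l` characters. -/
def filterScan (p : Params) (l : ℕ) : ℕ :=
  transfers (p.B * Nat.log p.lam p.N) 0 (p.lam ^ p.h l)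

/-! ### Stored data -/

variable {V : Type*}

/-- A fingerprint-value pair as stored in a run, with its previous field: the number of the
latest earlier run of the level that contains a fingerprint with the same prefix, or the number
of its own run if there is none. -/
structure Entry (p : Params) (V : Type*) where
  fp : Fingerprint p
  val : V
  prev : ℕ

/-- A level.  The run with number `j ≥ 1` is the `j`-th one to have arrived, and each run is
sorted by fingerprint.  The routing filter maps a prefix to the number of the latest run containing
a fingerprint with that prefix, or to `0` if there is none. -/
structure Level (p : Params) (V : Type*) where
  runs : List (List (Entry p V))
  filter : ℕ → ℕ

/-- The level without runs. -/
def Level.blank (p : Params) (V : Type*) : Level p V := ⟨[], fun _ => 0⟩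

/-- A BOA: a buffer in memory (latest pair first) and the levels on disk. -/
structure Table (p : Params) (V : Type*) where
  buffer : List (Fingerprint p × V)
  levels : List (Level p V)

/-- The empty BOA. -/
def Table.empty (p : Params) (V : Type*) : Table p V := ⟨[], []⟩

/-- The prefix of `h l` characters of a fingerprint (all of it, if it is shorter). -/
def prefixOf (p : Params) (l : ℕ) (K : Fingerprint p) : ℕ :=
  K.val / p.lam ^ (p.len - p.h l)

/-! ### The layout of a run

The range of fingerprints is divided into `lam ^ l = (B * lam ^ l) / B` buckets of equal width.
With `F` the number of entries in the fullest bucket, the entries of bucket `i` are written to the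
`F` cells from cell `i * F` on.  Should `F` exceed `slack * B`, which is improbable for hashed keys,
then the run is written as a plain sorted array.  One further block, the header, records `F`. -/

/-- The bucket of a fingerprint in a run on level `l`. -/
def bucketOf (p : Params) (l : ℕ) (K : Fingerprint p) : ℕ :=
  K.val * p.lam ^ l / p.lam ^ p.len

/-- The number of entries in the fullest bucket. -/
def fullest (p : Params) (l : ℕ) (r : List (Entry p V)) : ℕ :=
  (Finset.range (p.lam ^ l)).sup fun i => r.countP fun e => bucketOf p l e.fp = i

/-- Whether the run is written in equal-sized buckets. -/
def Bucketed (p : Params) (l : ℕ) (r : List (Entry p V)) : Prop :=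
  fullest p l r ≤ p.slack * p.B

instance (p : Params) (l : ℕ) (r : List (Entry p V)) : Decidable (Bucketed p l r) :=
  inferInstanceAs (Decidable (_ ≤ _))

/-- The number of cells of a run, without the header. -/
def runCells (p : Params) (l : ℕ) (r : List (Entry p V)) : ℕ :=
  if Bucketed p l r then p.lam ^ l * fullest p l r else r.length

/-- Transfers made by one sequential scan (reading or writing) of a run with its header. -/
def runScan (p : Params) (l : ℕ) (r : List (Entry p V)) : ℕ :=
  1 + transfers p.B 0 (runCells p l r)

/-- Fetch the part of a run that may contain `K`: the header and the bucket of `K`, or the whole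
array if the run is not bucketed. -/
def fetch (p : Params) (l : ℕ) (r : List (Entry p V)) (K : Fingerprint p) :
    List (Entry p V) × ℕ :=
  if Bucketed p l r then
    (r.filter fun e => bucketOf p l e.fp = bucketOf p l K,
      1 + transfers p.B (bucketOf p l K * fullest p l r) (fullest p l r))
  else (r, 1 + transfers p.B 0 r.length)

/-! ### Merging -/

/-- Comparison of pairs by fingerprint. -/
def le (p : Params) (x y : Fingerprint p × V) : Bool := x.1 ≤ y.1

/-- A sorted file on disk, with the number of transfers made by reading it sequentially. -/
structure File (p : Params) (V : Type*) where
  pairs : List (Fingerprint p × V)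
  blocks : ℕ

/-- The file consisting of a sorted list of pairs in consecutive cells. -/
def File.plain (p : Params) (s : List (Fingerprint p × V)) : File p V :=
  ⟨s, transfers p.B 0 s.length⟩

/-- A run of level `l`, read sequentially. -/
def File.ofRun (p : Params) (l : ℕ) (r : List (Entry p V)) : File p V :=
  ⟨r.map fun e => (e.fp, e.val), runScan p l r⟩

/-- The number of files that can be merged at once: memory holds one block of each of them and
one block of the output. -/
def fanIn (p : Params) : ℕ := p.M / p.B - 1

/-- Merge files (at most `fanIn` of them) in one sequential scan into one plain file. -/
def mergeOnce (p : Params) (fs : List (File p V)) : File p V × ℕ :=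
  let out := File.plain p (fs.foldr (fun f acc => List.merge f.pairs acc (le p)) [])
  (out, (fs.map File.blocks).sum + out.blocks)

/-- Cut a list into consecutive pieces of length `m` (the last one may be shorter). -/
def pieces {α : Type*} (m : ℕ) (s : List α) : List (List α) :=
  (List.range ((s.length + m - 1) / m)).map fun i => (s.drop (i * m)).take m

/-- One pass of multiway merging: merge each group of `fanIn` consecutive files. -/
def mergePass (p : Params) (fs : List (File p V)) : List (File p V) × ℕ :=
  let outs := (pieces (fanIn p) fs).map (mergeOnce p)
  (outs.map Prod.fst, (outs.map Prod.snd).sum)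

/-- Merge passes until one file is left.  The first argument bounds the number of passes. -/
def mergePasses (p : Params) : ℕ → List (File p V) → List (File p V) × ℕ
  | 0, fs => (fs, 0)
  | n + 1, fs =>
    if fs.length ≤ 1 then (fs, 0)
    else
      let a := mergePass p fs
      let b := mergePasses p n a.1
      (b.1, a.2 + b.2)

/-- Multiway merge sort of sorted files into one plain file.  When `fanIn` is at least `2`, each pass
on two or more files reduces their number, so the bound on the number of passes is not met
before one file is left. -/
def mergeFiles (p : Params) (fs : List (File p V)) : List (Fingerprint p × V) × ℕ :=
  let a := mergePasses p fs.length fs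
  (a.1.flatMap File.pairs, a.2)

/-! ### Insertion -/

/-- Add a new run, given as a plain sorted file, to level `l`.  The file and the routing filter
are read, and the run (with its previous fields) and the new routing filter are written, all
sequentially. -/
def place (p : Params) (l : ℕ) (lv : Level p V) (s : List (Fingerprint p × V)) :
    Level p V × ℕ :=
  let j := lv.runs.length + 1
  let r : List (Entry p V) := s.map fun x =>
    { fp := x.1
      val := x.2
      prev := if lv.filter (prefixOf p l x.1) = 0 then j else lv.filter (prefixOf p l x.1) }
  let filter' : ℕ → ℕ := fun i =>
    if s.any (fun x => prefixOf p l x.1 = i) then j else lv.filter i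
  (⟨lv.runs ++ [r], filter'⟩,
    transfers p.B 0 s.length + filterScan p l + filterScan p l + runScan p l r)

/-- A new run, given as a plain sorted file, arrives at level `l`; the list contains the levels
from `l` on.  A missing level is set up first, by writing a blank routing filter.  If the run is
the `lam`-th one on its level, then the `lam` runs are merged into one, the routing filter of the
level is overwritten by a blank one, and the merged run arrives at the next level. -/
def arrive (p : Params) : ℕ → List (Level p V) → List (Fingerprint p × V) →
    List (Level p V) × ℕ
  | l, [], s =>
    let a := place p l (Level.blank p V) s
    ([a.1], filterScan p l + a.2)
  | l, lv :: rest, s =>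
    if lv.runs.length + 1 < p.lam then
      let a := place p l lv s
      (a.1 :: rest, a.2)
    else
      let a := mergeFiles p (lv.runs.map (File.ofRun p l) ++ [File.plain p s])
      let b := arrive p (l + 1) rest a.1
      (Level.blank p V :: b.1, a.2 + filterScan p l + b.2)

/-- Insert a fingerprint-value pair.  When the buffer has `B` pairs, it is sorted in memory, written
to disk, and arrives at level `0` as a new run. -/
def insert (p : Params) (t : Table p V) (x : Fingerprint p × V) : Table p V × ℕ :=
  if t.buffer.length + 1 < p.B then (⟨x :: t.buffer, t.levels⟩, 0)
  else
    let s := (x :: t.buffer).mergeSort (le p)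
    let a := arrive p 0 t.levels s
    (⟨[], a.1⟩, transfers p.B 0 s.length + a.2)

/-- Insert the pairs of a list, from left to right, into the empty BOA.  The number is the total
number of transfers. -/
def insertAll (p : Params) (xs : List (Fingerprint p × V)) : Table p V × ℕ :=
  xs.foldl (fun t x => ((insert p t.1 x).1, t.2 + (insert p t.1 x).2)) (Table.empty p V, 0)

/-! ### Queries -/

/-- Look for `K` in run number `j` of a level, and then in all further runs to which the previous
fields of the entries with the same prefix lead.  The first argument bounds the number of runs. -/
def chase (p : Params) (l : ℕ) (lv : Level p V) (K : Fingerprint p) : ℕ → ℕ → Option V × ℕ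
  | 0, _ => (none, 0)
  | n + 1, j =>
    match lv.runs[j - 1]? with
    | none => (none, 0)
    | some r =>
      let a := fetch p l r K
      let matching := a.1.filter fun e => prefixOf p l e.fp = prefixOf p l K
      let found := (matching.find? fun e => e.fp = K).map Entry.val
      match matching.head? with
      | none => (found, a.2)
      | some e =>
        if e.prev = j then (found, a.2)
        else
          let b := chase p l lv K n e.prev
          (found.or b.1, a.2 + b.2)

/-- Look for `K` on level `l`: read the character of the routing filter for the prefix of `K`, and
search the runs to which it leads. -/
def queryLevel (p : Params) (l : ℕ) (lv : Level p V) (K : Fingerprint p) : Option V × ℕ :=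
  let j := lv.filter (prefixOf p l K)
  if j = 0 then (none, 1)
  else
    let a := chase p l lv K lv.runs.length j
    (a.1, 1 + a.2)

/-- Look for `K` on all levels from `l` on, which the list contains. -/
def queryLevels (p : Params) (K : Fingerprint p) : ℕ → List (Level p V) → Option V × ℕ
  | _, [] => (none, 0)
  | l, lv :: rest =>
    let a := queryLevel p l lv K
    let b := queryLevels p K (l + 1) rest
    (a.1.or b.1, a.2 + b.2)

/-- Query a BOA for a fingerprint. -/
def query (p : Params) (t : Table p V) (K : Fingerprint p) : Option V × ℕ :=
  let a := queryLevels p K 0 t.levels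
  (((t.buffer.find? fun x => x.1 = K).map Prod.snd).or a.1, a.2)

/-! ### Hashing -/

open MeasureTheory ProbabilityTheory in
/-- `H`, a random function from keys to `Fin U`, is a `k`-wise independent hash function: the
hashes of any key are uniformly distributed, and those of at most `k` keys are independent. -/
structure IsKWiseIndependent {Ω κ : Type*} [MeasurableSpace Ω] (μ : Measure Ω) (k U : ℕ)
    (H : κ → Ω → Fin U) : Prop where
  measurable : ∀ x, Measurable (H x)
  uniform : ∀ x v, μ (H x ⁻¹' {v}) = (U : ENNReal)⁻¹
  indep : ∀ s : Finset κ, s.card ≤ k → iIndepFun (fun x : s => H x) μ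

end BOA

/-! The distribution of the inserted items over buffer, levels and runs is that of a counter in base
`lam`, and it does not depend on the fingerprints. It is therefore described by a deterministic
structure of items (`insertItems`), to which every actual table is tied by permutations
(`insertAll_sim`). Sortedness plays no role in either cost bound. For at most `N` items there are at
most `log_lam N + 1` levels.

Insertions are paid for by the entries, all costs being multiplied by `B`. With `g = ⌊log_lam N⌋`
characters per cell, scanning the filter of a level costs at most `β / g + 1` per entry of a run, so
over the `O(g)` levels the filters cost `O(β + g)`. Merging `lam` runs takes at most `⌈log_f lam⌉`
passes, where `f` is the fan-in; since `log_lam N * log_f lam = log_f N` and `f` is at least the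
square root of `M / B`, all levels together give `O(log_lam N + log_{M/B} N)`. The accounting is
`arrive_cost`, and `insertAll_cost` evaluates it.

A query fetches only from runs that contain the prefix sought, each at most once, because previous
fields lead strictly backwards (`chase_cost_le`). The number of such runs is at most the number of
items on the level with that prefix. By pairwise independence its expectation is at most `1 + lam /
β + 1 / c`: the sought key itself, then fewer than `lam` runs of `B * lam ^ l` items against `β * B
* lam ^ l` prefixes, then a term for the finite universe. A fetch costs `O(1)` unless the run has an
overfull bucket. A binomial moment of order `⌈c log N⌉`, which needs no more independence than is
given, shows that a given bucket is overfull with probability at most `1 / N ^ 2`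
(`measure_bucket_overflow_le`). This makes up for the `lam ^ l` buckets of a run and the `O(lam ^
l)` cost of reading it whole. -/

namespace BOA

variable {V α : Type*}

/-! ### Block transfers -/

/-- An unaligned segment may meet a partial block at either end, hence `2`; from cell `0` on, `1`
suffices. -/
theorem transfers_le (b start n : ℕ) : transfers b start n ≤ n / b + 2 := by
  unfold transfers
  split_ifs with h
  · exact Nat.zero_le _
  · rcases Nat.eq_zero_or_pos b with rfl | hb
    · simp
    · have h1 : start + n - 1 < b * (start / b + n / b + 2) := by
        have := Nat.lt_mul_div_succ start hb
        have := Nat.lt_mul_div_succ n hb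
        have e : b * (start / b + n / b + 2) = b * (start / b + 1) + b * (n / b + 1) := by ring
        omega
      have h2 := Nat.div_lt_of_lt_mul h1
      generalize n / b = x at *
      omega

theorem transfers_zero_le (b n : ℕ) : transfers b 0 n ≤ n / b + 1 := by
  unfold transfers
  split_ifs with h
  · exact Nat.zero_le _
  · have : (0 + n - 1) / b ≤ n / b := Nat.div_le_div_right (by omega)
    rw [Nat.zero_div, Nat.sub_zero]
    exact Nat.succ_le_succ this

theorem mul_transfers_zero_le (b n : ℕ) : b * transfers b 0 n ≤ n + b := by
  have h1 := Nat.mul_le_mul_left b (transfers_zero_le b n)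
  have h2 := Nat.mul_div_le n b
  rw [Nat.mul_add] at h1
  omega

/-- The factor `slack + 1` serves both layouts, the bucketed one and the plain one (even for `slack
= 0`). -/
theorem runCells_le (p : Params) (l : ℕ) (r : List (Entry p V))
    (hr : r.length = p.B * p.lam ^ l) : runCells p l r ≤ (p.slack + 1) * (p.B * p.lam ^ l) := by
  unfold runCells
  split_ifs with h
  · calc p.lam ^ l * fullest p l r ≤ p.lam ^ l * (p.slack * p.B) := Nat.mul_le_mul_left _ h
      _ = p.slack * (p.B * p.lam ^ l) := by ring
      _ ≤ _ := Nat.mul_le_mul_right _ (Nat.le_succ _)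
  · rw [hr]
    exact Nat.le_mul_of_pos_left _ (Nat.succ_pos _)

/-- A run fills at least one block, so the header and the rounding to full blocks each add at most
`1` to the factor `slack + 1`. -/
theorem mul_runScan_le (p : Params) (l : ℕ) (r : List (Entry p V)) (hlam : 1 ≤ p.lam)
    (hr : r.length = p.B * p.lam ^ l) :
    p.B * runScan p l r ≤ (p.slack + 3) * (p.B * p.lam ^ l) := by
  have h1 := mul_transfers_zero_le p.B (runCells p l r)
  have h2 := runCells_le p l r hr
  have h3 : p.B ≤ p.B * p.lam ^ l := Nat.le_mul_of_pos_right _ (Nat.pow_pos hlam)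
  unfold runScan
  rw [Nat.mul_add, Nat.mul_one]
  linarith

/-! ### Merging -/

theorem pieces_ne_nil {α : Type*} {m : ℕ} {s t : List α} (hm : 1 ≤ m) (ht : t ∈ pieces m s) :
    t ≠ [] := by
  unfold pieces at ht
  obtain ⟨i, hi, rfl⟩ := List.mem_map.1 ht
  rw [List.mem_range] at hi
  have h1 : i * m < s.length := by
    have h := (Nat.le_div_iff_mul_le hm).1 hi
    rw [Nat.succ_mul] at h
    omega
  intro h
  have := congrArg List.length h
  simp only [List.length_take, List.length_drop, List.length_nil] at this
  omega

theorem flatten_map_range_take_drop {α : Type*} (m : ℕ) (s : List α) (n : ℕ) :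
    ((List.range n).map fun i => (s.drop (i * m)).take m).flatten = s.take (n * m) := by
  induction n with
  | zero => simp
  | succ n ih =>
    rw [List.range_succ, List.map_append, List.flatten_append, ih, Nat.succ_mul, List.take_add]
    simp

theorem flatten_pieces {α : Type*} {m : ℕ} (hm : 1 ≤ m) (s : List α) :
    (pieces m s).flatten = s := by
  unfold pieces
  rw [flatten_map_range_take_drop, List.take_of_length_le]
  have h := Nat.lt_div_mul_add (a := s.length + m - 1) hm
  omega

/-- One merge pass lowers the exponent by one; this is what bounds the number of passes. -/
theorem length_pieces_le {α : Type*} {m t : ℕ} (hm : 1 ≤ m) {s : List α}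
    (hs : s.length ≤ m ^ (t + 1)) : (pieces m s).length ≤ m ^ t := by
  unfold pieces
  rw [List.length_map, List.length_range]
  refine Nat.le_of_lt_succ (Nat.div_lt_of_lt_mul ?_)
  rw [Nat.mul_succ, ← pow_succ']
  omega

theorem foldr_merge_perm (p : Params) (fs : List (File p V)) :
    (fs.foldr (fun f acc => List.merge f.pairs acc (le p)) []).Perm
      (fs.flatMap File.pairs) := by
  induction fs with
  | nil => simp
  | cons f fs ih =>
    rw [List.foldr_cons, List.flatMap_cons]
    exact (List.merge_perm_append _).trans (ih.append_left _)

theorem mergePass_perm (p : Params) (hf : 1 ≤ fanIn p) (fs : List (File p V)) :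
    ((mergePass p fs).1.flatMap File.pairs).Perm (fs.flatMap File.pairs) := by
  have key : ∀ gs : List (List (File p V)),
      (((gs.map (mergeOnce p)).map Prod.fst).flatMap File.pairs).Perm
        (gs.flatten.flatMap File.pairs) := by
    intro gs
    induction gs with
    | nil => simp
    | cons g gs ih =>
      simp only [List.map_cons, List.flatMap_cons, List.flatten_cons, List.flatMap_append]
      exact (foldr_merge_perm p g).append ih
  have h := key (pieces (fanIn p) fs)
  rwa [flatten_pieces hf] at h

theorem mergePasses_perm (p : Params) (hf : 1 ≤ fanIn p) (n : ℕ) (fs : List (File p V)) :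
    ((mergePasses p n fs).1.flatMap File.pairs).Perm (fs.flatMap File.pairs) := by
  induction n generalizing fs with
  | zero => rfl
  | succ n ih =>
    unfold mergePasses
    split_ifs
    · rfl
    · exact (ih _).trans (mergePass_perm p hf fs)

theorem mergeFiles_perm (p : Params) (hf : 1 ≤ fanIn p) (fs : List (File p V)) :
    (mergeFiles p fs).1.Perm (fs.flatMap File.pairs) :=
  mergePasses_perm p hf _ fs

/-- A file of at least one block that is stored with overhead at most `D`. -/
def File.Dense (p : Params) (D : ℕ) (f : File p V) : Prop :=
  p.B ≤ f.pairs.length ∧ p.B * f.blocks ≤ D * f.pairs.length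

theorem File.dense_plain (p : Params) {D : ℕ} (hD : 2 ≤ D) {s : List (Fingerprint p × V)}
    (hs : p.B ≤ s.length) : (File.plain p s).Dense p D := by
  refine ⟨hs, (mul_transfers_zero_le _ _).trans ?_⟩
  have := Nat.mul_le_mul_right s.length hD
  change s.length + p.B ≤ D * s.length
  omega

theorem sum_blocks_le (p : Params) {D : ℕ} {fs : List (File p V)}
    (h : ∀ f ∈ fs, f.Dense p D) :
    p.B * (fs.map File.blocks).sum ≤ D * (fs.flatMap File.pairs).length := by
  induction fs with
  | nil => simp
  | cons f fs ih =>
    have h1 := (h f (by simp)).2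
    have h2 := ih fun g hg => h g (by simp [hg])
    simp only [List.map_cons, List.sum_cons, List.flatMap_cons, List.length_append, Nat.mul_add]
    omega

theorem dense_mergeOnce (p : Params) {D : ℕ} (hD : 2 ≤ D) {fs : List (File p V)} (hne : fs ≠ [])
    (h : ∀ f ∈ fs, f.Dense p D) : (mergeOnce p fs).1.Dense p D := by
  refine File.dense_plain p hD ?_
  rw [(foldr_merge_perm p fs).length_eq]
  obtain ⟨f, gs, rfl⟩ := List.exists_cons_of_ne_nil hne
  have := (h f (by simp)).1
  simp only [List.flatMap_cons, List.length_append]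
  omega

/-- Reading the inputs and writing the output cost at most `D` per pair each, since the output is
dense as well. -/
theorem mergeOnce_cost (p : Params) {D : ℕ} (hD : 2 ≤ D) {fs : List (File p V)} (hne : fs ≠ [])
    (h : ∀ f ∈ fs, f.Dense p D) :
    p.B * (mergeOnce p fs).2 ≤ 2 * D * (fs.flatMap File.pairs).length := by
  have h1 := sum_blocks_le p h
  have h2 := (dense_mergeOnce p hD hne h).2
  have h3 : (mergeOnce p fs).1.pairs.length = (fs.flatMap File.pairs).length :=
    (foldr_merge_perm p fs).length_eq
  rw [h3] at h2
  change p.B * ((fs.map File.blocks).sum + (mergeOnce p fs).1.blocks) ≤ _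
  rw [Nat.mul_add]
  linarith

theorem dense_mergePass (p : Params) (hf : 1 ≤ fanIn p) {D : ℕ} (hD : 2 ≤ D)
    {fs : List (File p V)} (h : ∀ f ∈ fs, f.Dense p D) :
    ∀ f ∈ (mergePass p fs).1, f.Dense p D := by
  intro f hfm
  obtain ⟨x, hx, rfl⟩ := List.mem_map.1 hfm
  obtain ⟨g, hg, rfl⟩ := List.mem_map.1 hx
  refine dense_mergeOnce p hD (pieces_ne_nil hf hg) fun f' hf' => h f' ?_
  rw [← flatten_pieces hf fs]
  exact List.mem_flatten.2 ⟨g, hg, hf'⟩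

theorem mergePass_cost (p : Params) (hf : 1 ≤ fanIn p) {D : ℕ} (hD : 2 ≤ D)
    {fs : List (File p V)} (h : ∀ f ∈ fs, f.Dense p D) :
    p.B * (mergePass p fs).2 ≤ 2 * D * (fs.flatMap File.pairs).length := by
  have key : ∀ gs : List (List (File p V)), (∀ g ∈ gs, g ≠ []) →
      (∀ g ∈ gs, ∀ f ∈ g, f.Dense p D) →
      p.B * ((gs.map (mergeOnce p)).map Prod.snd).sum ≤
        2 * D * (gs.flatten.flatMap File.pairs).length := by
    intro gs
    induction gs with
    | nil => simp
    | cons g gs ih =>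
      intro hne hd
      have h1 := mergeOnce_cost p hD (hne g (by simp)) (hd g (by simp))
      have h2 := ih (fun g' hg' => hne g' (by simp [hg'])) fun g' hg' => hd g' (by simp [hg'])
      simp only [List.map_cons, List.sum_cons, List.flatten_cons, List.flatMap_append,
        List.length_append, Nat.mul_add]
      exact Nat.add_le_add h1 h2
  have h' := key (pieces (fanIn p) fs) (fun g hg => pieces_ne_nil hf hg) fun g hg f hfg => h f (by
    rw [← flatten_pieces hf fs]
    exact List.mem_flatten.2 ⟨g, hg, hfg⟩)
  rwa [flatten_pieces hf] at h'

/-- A pass keeps the pairs and the density, so all passes obey the same bound. The number of passes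
that count is governed by `t`, whatever the recursion bound `n`. -/
theorem mergePasses_cost (p : Params) (hf : 1 ≤ fanIn p) {D : ℕ} (hD : 2 ≤ D) (n t : ℕ)
    {fs : List (File p V)} (h : ∀ f ∈ fs, f.Dense p D) (ht : fs.length ≤ fanIn p ^ t) :
    p.B * (mergePasses p n fs).2 ≤ t * (2 * D * (fs.flatMap File.pairs).length) := by
  induction n generalizing fs t with
  | zero => simp [mergePasses]
  | succ n ih =>
    unfold mergePasses
    split_ifs with h1
    · simp
    · obtain _ | t := t
      · simp at ht
        omega
      · have h2 := ih t (dense_mergePass p hf hD h) (by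
          change (((pieces (fanIn p) fs).map (mergeOnce p)).map Prod.fst).length ≤ _
          rw [List.length_map, List.length_map]
          exact length_pieces_le hf ht)
        rw [(mergePass_perm p hf fs).length_eq] at h2
        have h3 := mergePass_cost p hf hD h
        rw [Nat.mul_add, Nat.succ_mul t]
        omega

theorem mergeFiles_cost (p : Params) (hf : 2 ≤ fanIn p) {D : ℕ} (hD : 2 ≤ D)
    {fs : List (File p V)} (h : ∀ f ∈ fs, f.Dense p D) :
    p.B * (mergeFiles p fs).2 ≤
      Nat.clog (fanIn p) fs.length * (2 * D * (fs.flatMap File.pairs).length) :=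
  mergePasses_cost p (by omega) hD _ _ h (Nat.le_pow_clog (by omega) _)

/-! ### The flow of items

The way in which inserted items are distributed over buffer and runs does not depend on the
fingerprints.  It is described here for items of any type, up to the order within a run. -/

/-- Arrival of a run of items. -/
def arriveItems (lam : ℕ) : List (List (List α)) → List α → List (List (List α))
  | [], s => [[s]]
  | lv :: rest, s =>
    if lv.length + 1 < lam then (lv ++ [s]) :: rest
    else [] :: arriveItems lam rest (lv.flatten ++ s)

/-- Insertion of an item. -/
def insertItem (B lam : ℕ) (t : List α × List (List (List α))) (x : α) :
    List α × List (List (List α)) :=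
  if t.1.length + 1 < B then (x :: t.1, t.2) else ([], arriveItems lam t.2 (x :: t.1))

/-- Insertion of a list of items into the empty structure. -/
def insertItems (B lam : ℕ) (xs : List α) : List α × List (List (List α)) :=
  xs.foldl (insertItem B lam) ([], [])

theorem insertItems_append_singleton (B lam : ℕ) (xs : List α) (x : α) :
    insertItems B lam (xs ++ [x]) = insertItem B lam (insertItems B lam xs) x := by
  simp [insertItems]

/-- The levels, from `l` on, consist of fewer than `lam` runs each, all of the proper size. -/
def Sized (B lam : ℕ) : ℕ → List (List (List α)) → Prop
  | _, [] => True
  | l, lv :: rest =>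
    lv.length < lam ∧ (∀ r ∈ lv, r.length = B * lam ^ l) ∧ Sized B lam (l + 1) rest

theorem length_flatten_of_forall {m : ℕ} {lv : List (List α)} (h : ∀ r ∈ lv, r.length = m) :
    lv.flatten.length = lv.length * m := by
  induction lv with
  | nil => simp
  | cons r lv ih =>
    rw [List.flatten_cons, List.length_append, ih fun r' hr' => h r' (by simp [hr']),
      h r (by simp), List.length_cons, Nat.succ_mul, Nat.add_comm]

theorem length_merged {B lam l : ℕ} {lv : List (List α)} {s : List α} (hl : lv.length < lam)
    (hlam : ¬ lv.length + 1 < lam) (hr : ∀ r ∈ lv, r.length = B * lam ^ l)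
    (hs : s.length = B * lam ^ l) : (lv.flatten ++ s).length = B * lam ^ (l + 1) := by
  have e : lv.length + 1 = lam := by omega
  rw [List.length_append, length_flatten_of_forall hr, hs, ← Nat.succ_mul, Nat.succ_eq_add_one,
    e, pow_succ]
  ring

theorem sized_arriveItems {B lam : ℕ} (hlam : 2 ≤ lam) (l : ℕ) (lvs : List (List (List α)))
    (s : List α) (h : Sized B lam l lvs) (hs : s.length = B * lam ^ l) :
    Sized B lam l (arriveItems lam lvs s) := by
  induction lvs generalizing l s with
  | nil =>
    refine ⟨hlam, ?_, trivial⟩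
    simpa using hs
  | cons lv rest ih =>
    obtain ⟨h1, h2, h3⟩ := h
    unfold arriveItems
    split_ifs with hc
    · refine ⟨by simpa using hc, ?_, h3⟩
      intro r hr
      rcases List.mem_append.1 hr with hr | hr
      · exact h2 r hr
      · rw [List.mem_singleton.1 hr, hs]
    · exact ⟨by simp; omega, by simp, ih _ _ h3 (length_merged h1 hc h2 hs)⟩

theorem perm_arriveItems (lam : ℕ) (lvs : List (List (List α))) (s : List α) :
    (arriveItems lam lvs s).flatten.flatten.Perm (s ++ lvs.flatten.flatten) := by
  induction lvs generalizing s with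
  | nil => simp [arriveItems]
  | cons lv rest ih =>
    unfold arriveItems
    split_ifs
    · simp only [List.flatten_cons, List.flatten_append, List.append_assoc, List.flatten_nil,
        List.nil_append]
      rw [← List.append_assoc, ← List.append_assoc]
      exact List.perm_append_comm.append_right _
    · simp only [List.flatten_cons, List.flatten_append, List.nil_append]
      refine (ih _).trans ?_
      rw [← List.append_assoc]
      exact List.perm_append_comm.append_right _

/-- A new level appears only when the carry runs through all existing levels, and then the carried
run is already as large as a run of the new level. -/
theorem length_arriveItems {B lam : ℕ} (l : ℕ) (lvs : List (List (List α)))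
    (s : List α) (h : Sized B lam l lvs) (hs : s.length = B * lam ^ l) :
    (arriveItems lam lvs s).length = lvs.length ∨
      (arriveItems lam lvs s).length = lvs.length + 1 ∧
        B * lam ^ (l + lvs.length) ≤ s.length + lvs.flatten.flatten.length := by
  induction lvs generalizing l s with
  | nil => right; simp [arriveItems, hs]
  | cons lv rest ih =>
    obtain ⟨h1, h2, h3⟩ := h
    unfold arriveItems
    split_ifs with hc
    · left; simp
    · rcases ih (l + 1) _ h3 (length_merged h1 hc h2 hs) with h | ⟨h, h'⟩
      · left; simp [h]
      · right
        refine ⟨by simp [h], ?_⟩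
        rw [List.length_cons, Nat.add_comm rest.length, ← Nat.add_assoc]
        refine h'.trans (le_of_eq ?_)
        simp only [List.flatten_cons, List.flatten_append, List.length_append]
        omega

/-- The invariants of the counter, proved together. The last one bounds the number of levels
logarithmically. -/
theorem insertItems_spec {B lam : ℕ} (hB : 1 ≤ B) (hlam : 2 ≤ lam) (xs : List α) :
    (insertItems B lam xs).1.length < B ∧ Sized B lam 0 (insertItems B lam xs).2 ∧
      ((insertItems B lam xs).1 ++ (insertItems B lam xs).2.flatten.flatten).Perm xs ∧
      ((insertItems B lam xs).2.length = 0 ∨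
        B * lam ^ ((insertItems B lam xs).2.length - 1) ≤ xs.length) := by
  induction xs using List.reverseRecOn with
  | nil => simp [insertItems, Sized]; omega
  | append_singleton xs x ih =>
    rw [insertItems_append_singleton]
    generalize insertItems B lam xs = t at ih
    obtain ⟨h1, h2, h3, h4⟩ := ih
    have h5 : (x :: t.1 ++ t.2.flatten.flatten).Perm (xs ++ [x]) :=
      (h3.cons x).trans (List.perm_append_singleton x xs).symm
    unfold insertItem
    split_ifs with hc
    · refine ⟨hc, h2, h5, h4.imp_right fun h => ?_⟩
      rw [List.length_append]
      exact h.trans (Nat.le_add_right _ _)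
    · have hs : (x :: t.1).length = B * lam ^ 0 := by
        rw [List.length_cons, pow_zero, Nat.mul_one]
        omega
      refine ⟨hB, sized_arriveItems hlam 0 _ _ h2 hs,
        (perm_arriveItems _ _ _).trans h5, ?_⟩
      have h6 := h5.length_eq
      rw [List.length_append] at h6
      rcases length_arriveItems 0 t.2 _ h2 hs with h | ⟨h, h'⟩
      · rw [h, List.length_append]
        exact h4.imp_right fun h => by omega
      · right
        rw [h]
        simp only [Nat.zero_add, Nat.add_sub_cancel] at h' ⊢
        omega

theorem length_levels_le {B lam N : ℕ} (hB : 1 ≤ B) (hlam : 2 ≤ lam) {xs : List α}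
    (hN : xs.length ≤ N) : (insertItems B lam xs).2.length ≤ Nat.log lam N + 1 := by
  rcases (insertItems_spec hB hlam xs).2.2.2 with h | h
  · omega
  · have h1 : lam ^ ((insertItems B lam xs).2.length - 1) ≤ N :=
      (Nat.le_mul_of_pos_left _ hB).trans (h.trans hN)
    have := Nat.le_log_of_pow_le (by omega) h1
    omega

/-! ### Tables and items -/

/-- A run consists of the pairs that belong to the given items. -/
def RunSim (p : Params) (f : α → Fingerprint p × V) (r : List (Entry p V)) (a : List α) : Prop :=
  (r.map fun e => (e.fp, e.val)).Perm (a.map f)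

/-- A level consists of runs of the given items. -/
def LevelSim (p : Params) (f : α → Fingerprint p × V) (lv : Level p V)
    (a : List (List α)) : Prop :=
  List.Forall₂ (RunSim p f) lv.runs a

theorem RunSim.length_eq {p : Params} {f : α → Fingerprint p × V} {r : List (Entry p V)}
    {a : List α} (h : RunSim p f r a) : r.length = a.length := by
  simpa using List.Perm.length_eq h

theorem LevelSim.forall_length {p : Params} {f : α → Fingerprint p × V} {lv : Level p V}
    {a : List (List α)} {m : ℕ} (h : LevelSim p f lv a) (ha : ∀ r ∈ a, r.length = m) :
    ∀ r ∈ lv.runs, r.length = m := by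
  unfold LevelSim at h
  generalize lv.runs = rs at h
  induction h with
  | nil => simp
  | cons h _ ih =>
    intro r hr
    rcases List.mem_cons.1 hr with rfl | hr
    · rw [h.length_eq]; exact ha _ (by simp)
    · exact ih (fun r hr => ha r (by simp [hr])) r hr

theorem LevelSim.place {p : Params} {f : α → Fingerprint p × V} {lv : Level p V}
    {a : List (List α)} {s : List (Fingerprint p × V)} {b : List α} (l : ℕ)
    (h : LevelSim p f lv a) (hs : s.Perm (b.map f)) :
    LevelSim p f (place p l lv s).1 (a ++ [b]) := by
  refine List.rel_append h (List.Forall₂.cons ?_ List.Forall₂.nil)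
  unfold RunSim
  rw [List.map_map]
  simpa [Function.comp_def] using hs

theorem levelSim_blank (p : Params) (f : α → Fingerprint p × V) :
    LevelSim p f (Level.blank p V) [] := List.Forall₂.nil

/-- The files that are merged when a level is full. -/
def mergeInputs (p : Params) (l : ℕ) (lv : Level p V) (s : List (Fingerprint p × V)) :
    List (File p V) :=
  lv.runs.map (File.ofRun p l) ++ [File.plain p s]

theorem LevelSim.mergeInputs {p : Params} {f : α → Fingerprint p × V} {lv : Level p V}
    {a : List (List α)} {s : List (Fingerprint p × V)} {b : List α} (l : ℕ)
    (h : LevelSim p f lv a) (hs : s.Perm (b.map f)) :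
    ((mergeInputs p l lv s).flatMap File.pairs).Perm ((a.flatten ++ b).map f) := by
  unfold BOA.mergeInputs
  rw [List.flatMap_append, List.map_append]
  refine List.Perm.append ?_ (by simpa [File.plain] using hs)
  unfold LevelSim at h
  generalize lv.runs = rs at h
  induction h with
  | nil => simp
  | cons h _ ih =>
    simp only [List.map_cons, List.flatMap_cons, List.flatten_cons, List.map_append]
    exact List.Perm.append h ih

/-- Both recursions branch only on the number of runs, which agrees on the two sides, and merging
permutes the pairs. -/
theorem arrive_sim {p : Params} {f : α → Fingerprint p × V} (hf : 1 ≤ fanIn p) (l : ℕ)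
    {lvs : List (Level p V)} {as : List (List (List α))} {s : List (Fingerprint p × V)}
    {b : List α} (h : List.Forall₂ (LevelSim p f) lvs as) (hs : s.Perm (b.map f)) :
    List.Forall₂ (LevelSim p f) (arrive p l lvs s).1 (arriveItems p.lam as b) := by
  induction h generalizing l s b with
  | nil => exact List.Forall₂.cons ((levelSim_blank p f).place l hs) List.Forall₂.nil
  | @cons lv a rest as' h h' ih =>
    have e : lv.runs.length = a.length := List.Forall₂.length_eq h
    unfold arrive arriveItems
    rw [e]
    split_ifs with hc
    · exact List.Forall₂.cons (h.place l hs) h'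
    · exact List.Forall₂.cons (levelSim_blank p f)
        (ih (l + 1) ((mergeFiles_perm p hf _).trans (h.mergeInputs l hs)))

/-- A table holds the given items. -/
def TableSim (p : Params) (f : α → Fingerprint p × V) (t : Table p V)
    (a : List α × List (List (List α))) : Prop :=
  t.buffer = a.1.map f ∧ List.Forall₂ (LevelSim p f) t.levels a.2

theorem mergeSort_perm_map {p : Params} {f : α → Fingerprint p × V} {t : Table p V} {b : List α}
    (h : t.buffer = b.map f) (x : α) :
    ((f x :: t.buffer).mergeSort (le p)).Perm ((x :: b).map f) := by
  rw [h]
  exact List.mergeSort_perm _ _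

theorem TableSim.insert {p : Params} {f : α → Fingerprint p × V} (hf : 1 ≤ fanIn p)
    {t : Table p V} {a : List α × List (List (List α))} (h : TableSim p f t a) (x : α) :
    TableSim p f (insert p t (f x)).1 (insertItem p.B p.lam a x) := by
  have e : t.buffer.length = a.1.length := by rw [h.1, List.length_map]
  unfold BOA.insert insertItem
  rw [e]
  split_ifs
  · exact ⟨by simp [h.1], h.2⟩
  · exact ⟨rfl, arrive_sim hf 0 h.2 (mergeSort_perm_map h.1 x)⟩

theorem insertAll_append_singleton (p : Params) (xs : List (Fingerprint p × V))
    (x : Fingerprint p × V) : insertAll p (xs ++ [x]) =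
      ((insert p (insertAll p xs).1 x).1, (insertAll p xs).2 + (insert p (insertAll p xs).1 x).2) := by
  simp [insertAll]

/-- For hashed keys, `f` depends on the random hash function while the right-hand side does not: the
set of keys in each run is deterministic. -/
theorem insertAll_sim {p : Params} (f : α → Fingerprint p × V) (hf : 1 ≤ fanIn p)
    (xs : List α) : TableSim p f (insertAll p (xs.map f)).1 (insertItems p.B p.lam xs) := by
  induction xs using List.reverseRecOn with
  | nil => exact ⟨rfl, List.Forall₂.nil⟩
  | append_singleton xs x ih =>
    rw [insertItems_append_singleton, List.map_append, List.map_singleton,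
      insertAll_append_singleton]
    exact ih.insert hf x

/-! ### Insertion cost -/

theorem IsRoutingTableRatio.pos {p : Params} {β : ℝ} (hβ : IsRoutingTableRatio p β)
    (hlam : 1 ≤ p.lam) : 0 < β := by
  have h := hβ 0
  have h1 : (0 : ℝ) < (p.lam : ℝ) ^ p.h 0 := by
    have : (0 : ℝ) < p.lam := by exact_mod_cast hlam
    positivity
  rw [h] at h1
  exact pos_of_mul_pos_left h1 (by positivity)

/-- A block holds `B * log_lam N` characters, so packing divides `β` by the logarithm; the summand
`1` is the rounding to full blocks. -/
theorem filterScan_le {p : Params} {β : ℝ} (hβ : IsRoutingTableRatio p β) (hB : 1 ≤ p.B)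
    (hlam : 2 ≤ p.lam) (hN : p.lam ≤ p.N) (l : ℕ) :
    (p.B : ℝ) * filterScan p l ≤ (β / Nat.log p.lam p.N + 1) * (p.B * p.lam ^ l : ℕ) := by
  have hg : 1 ≤ Nat.log p.lam p.N := Nat.log_pos (by omega) hN
  have hB' : (0 : ℝ) < p.B := by exact_mod_cast hB
  have hg' : (0 : ℝ) < Nat.log p.lam p.N := by exact_mod_cast hg
  have h1 : (filterScan p l : ℝ) ≤
      ((p.lam ^ p.h l / (p.B * Nat.log p.lam p.N) : ℕ) : ℝ) + 1 := by
    exact_mod_cast transfers_zero_le _ _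
  have h2 : ((p.lam ^ p.h l / (p.B * Nat.log p.lam p.N) : ℕ) : ℝ) ≤
      ((p.lam ^ p.h l : ℕ) : ℝ) / ((p.B * Nat.log p.lam p.N : ℕ) : ℝ) := Nat.cast_div_le
  push_cast at h2
  rw [hβ l] at h2
  have h3 : β * (p.B * (p.lam : ℝ) ^ l) / (p.B * Nat.log p.lam p.N) =
      β / Nat.log p.lam p.N * (p.lam : ℝ) ^ l := by
    field_simp
  rw [h3] at h2
  have h4 : (1 : ℝ) ≤ (p.lam : ℝ) ^ l :=
    one_le_pow₀ (by exact_mod_cast (by omega : 1 ≤ p.lam))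
  push_cast
  calc (p.B : ℝ) * filterScan p l
      ≤ p.B * (β / Nat.log p.lam p.N * (p.lam : ℝ) ^ l + (p.lam : ℝ) ^ l) := by
        apply mul_le_mul_of_nonneg_left _ hB'.le
        linarith
    _ = _ := by ring

/-- What an entry on level `l` has paid for, when arrivals cost `wp` and merges cost `wm` per
entry. -/
def credit (wp wm : ℝ) : ℕ → List (List (List α)) → ℝ
  | _, [] => 0
  | l, lv :: rest =>
    -- The `2` pays for writing the buffer, `l * (wp + wm)` for passing through the lower levels,
    -- and the last `wp` for the arrival on level `l`.
    (2 + l * (wp + wm) + wp) * lv.flatten.length + credit wp wm (l + 1) rest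

theorem credit_le {wp wm : ℝ} (hp : 0 ≤ wp) (hm : 0 ≤ wm) (l : ℕ)
    (as : List (List (List α))) :
    credit wp wm l as ≤
      (2 + ((l + as.length : ℕ) : ℝ) * (wp + wm)) * as.flatten.flatten.length := by
  induction as generalizing l with
  | nil => simp [credit]
  | cons lv rest ih =>
    have h := ih (l + 1)
    rw [show l + 1 + rest.length = l + (lv :: rest).length by simp; omega] at h
    simp only [credit, List.flatten_cons, List.flatten_append, List.length_append, Nat.cast_add,
      List.length_cons, Nat.cast_one] at h ⊢
    have h1 : (2 + l * (wp + wm) + wp) ≤ 2 + ((l : ℝ) + (rest.length + 1)) * (wp + wm) := by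
      have : 0 ≤ (rest.length : ℝ) * (wp + wm) := by positivity
      linarith
    have h2 := mul_le_mul_of_nonneg_right h1 (Nat.cast_nonneg (α := ℝ) lv.flatten.length)
    linarith

/-- The cost of an arrival per entry, scaled by the block size. -/
def placeWeight (p : Params) (u : ℝ) : ℝ := (p.slack + 3 : ℕ) + 2 + 3 * u

/-- The cost of a merge per entry, scaled by the block size. -/
def mergeWeight (p : Params) (u : ℝ) : ℝ :=
  (2 * (p.slack + 3) * Nat.clog (fanIn p) p.lam : ℕ) + u

theorem place_cost {p : Params} {l : ℕ} {u : ℝ} (hlam : 1 ≤ p.lam)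
    (hu : (p.B : ℝ) * filterScan p l ≤ u * (p.B * p.lam ^ l : ℕ)) (lv : Level p V)
    {s : List (Fingerprint p × V)} (hs : s.length = p.B * p.lam ^ l) :
    (p.B : ℝ) * (filterScan p l + (place p l lv s).2 : ℕ) ≤ placeWeight p u * s.length := by
  have h1 := mul_transfers_zero_le p.B s.length
  have h2 : p.B ≤ p.B * p.lam ^ l := Nat.le_mul_of_pos_right _ (Nat.pow_pos hlam)
  rw [← hs] at h2 hu
  have h3 : ∃ r : List (Entry p V), r.length = p.B * p.lam ^ l ∧ (place p l lv s).2 =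
      transfers p.B 0 s.length + filterScan p l + filterScan p l + runScan p l r :=
    ⟨_, by rw [List.length_map, hs], rfl⟩
  obtain ⟨r, hr, h3⟩ := h3
  have h4 := mul_runScan_le p l r hlam hr
  rw [← hs] at h4
  have h5 : (p.B : ℝ) * transfers p.B 0 s.length ≤ 2 * s.length := by
    exact_mod_cast (by omega : p.B * transfers p.B 0 s.length ≤ 2 * s.length)
  have h6 : (p.B : ℝ) * runScan p l r ≤ (p.slack + 3 : ℕ) * s.length := by exact_mod_cast h4
  rw [h3]
  unfold placeWeight
  rw [Nat.cast_add, Nat.cast_add, Nat.cast_add, Nat.cast_add]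
  linarith

theorem dense_mergeInputs {p : Params} (hlam : 1 ≤ p.lam) {l : ℕ} {lv : Level p V}
    {s : List (Fingerprint p × V)} (hr : ∀ r ∈ lv.runs, r.length = p.B * p.lam ^ l)
    (hs : s.length = p.B * p.lam ^ l) : ∀ f ∈ mergeInputs p l lv s, f.Dense p (p.slack + 3) := by
  have h2 : p.B ≤ p.B * p.lam ^ l := Nat.le_mul_of_pos_right _ (Nat.pow_pos hlam)
  intro f hf
  rcases List.mem_append.1 hf with hf | hf
  · obtain ⟨r, hrm, rfl⟩ := List.mem_map.1 hf
    have e := hr r hrm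
    refine ⟨?_, ?_⟩
    · simpa [File.ofRun, e] using h2
    · simpa [File.ofRun, e] using mul_runScan_le p l r hlam e
  · rw [List.mem_singleton.1 hf]
    exact File.dense_plain p (by omega) (by rw [hs]; exact h2)

theorem merge_cost {p : Params} {l : ℕ} {u : ℝ} (hlam : 1 ≤ p.lam) (hf : 2 ≤ fanIn p)
    (hu : (p.B : ℝ) * filterScan p l ≤ u * (p.B * p.lam ^ l : ℕ))
    {lv : Level p V} {s : List (Fingerprint p × V)} (hlv : lv.runs.length < p.lam)
    (hr : ∀ r ∈ lv.runs, r.length = p.B * p.lam ^ l) (hs : s.length = p.B * p.lam ^ l)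
    {n : ℕ} (hn : ((mergeInputs p l lv s).flatMap File.pairs).length = n)
    (hn' : p.B * p.lam ^ l ≤ n) (hu0 : 0 ≤ u) :
    (p.B : ℝ) * ((mergeFiles p (mergeInputs p l lv s)).2 + filterScan p l : ℕ) ≤
      mergeWeight p u * n := by
  have h1 := mergeFiles_cost p hf (by omega) (dense_mergeInputs hlam hr hs)
  rw [hn] at h1
  have h2 : Nat.clog (fanIn p) (mergeInputs p l lv s).length ≤ Nat.clog (fanIn p) p.lam := by
    apply Nat.clog_mono_right
    simp only [mergeInputs, List.length_append, List.length_map, List.length_singleton]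
    omega
  have h3 : p.B * (mergeFiles p (mergeInputs p l lv s)).2 ≤
      2 * (p.slack + 3) * Nat.clog (fanIn p) p.lam * n := by
    refine (h1.trans (Nat.mul_le_mul_right _ h2)).trans (le_of_eq (by ring))
  have h4 : (p.B : ℝ) * (mergeFiles p (mergeInputs p l lv s)).2 ≤
      (2 * (p.slack + 3) * Nat.clog (fanIn p) p.lam : ℕ) * n := by exact_mod_cast h3
  have h5 : u * (p.B * p.lam ^ l : ℕ) ≤ u * n :=
    mul_le_mul_of_nonneg_left (by exact_mod_cast hn') hu0
  unfold mergeWeight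
  rw [Nat.cast_add]
  linarith

/-- The credit is the total paid so far, so its growth must cover the cost of the arrival. Entries
already on a merged level gain the merge weight; the arriving ones gain an arrival weight too. -/
theorem arrive_cost {p : Params} {u : ℝ} (hlam : 2 ≤ p.lam) (hf : 2 ≤ fanIn p) (hu0 : 0 ≤ u)
    (hu : ∀ l, (p.B : ℝ) * filterScan p l ≤ u * (p.B * p.lam ^ l : ℕ))
    {f : α → Fingerprint p × V} (l : ℕ) {lvs : List (Level p V)} {as : List (List (List α))}
    {s : List (Fingerprint p × V)} {b : List α} (h : List.Forall₂ (LevelSim p f) lvs as)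
    (hs : s.Perm (b.map f)) (hb : b.length = p.B * p.lam ^ l) (ha : Sized p.B p.lam l as) :
    credit (placeWeight p u) (mergeWeight p u) l as +
        (2 + l * (placeWeight p u + mergeWeight p u)) * b.length +
        p.B * (arrive p l lvs s).2 ≤
      credit (placeWeight p u) (mergeWeight p u) l (arriveItems p.lam as b) := by
  have hw : 0 ≤ placeWeight p u := by unfold placeWeight; positivity
  induction h generalizing l s b with
  | nil =>
    have hs' : s.length = b.length := by simpa using hs.length_eq
    have h1 := place_cost (by omega) (hu l) (Level.blank p V) (hs'.trans hb)
    rw [hs'] at h1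
    simp only [arrive, arriveItems, credit, List.flatten_cons, List.flatten_nil, List.append_nil]
    linarith
  | @cons lv a rest as' h h' ih =>
    have hs' : s.length = b.length := by simpa using hs.length_eq
    obtain ⟨h1, h2, h3⟩ := ha
    have e : lv.runs.length = a.length := List.Forall₂.length_eq h
    unfold arrive arriveItems
    rw [e]
    split_ifs with hc
    · have h4 := place_cost (by omega) (hu l) lv (hs'.trans hb)
      rw [hs'] at h4
      have h5 : (0 : ℝ) ≤ p.B * filterScan p l := by positivity
      rw [Nat.cast_add] at h4
      simp only [credit, List.flatten_append, List.flatten_cons, List.flatten_nil,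
        List.append_nil, List.length_append, Nat.cast_add]
      linarith
    · have h6 := ih (l + 1) ((mergeFiles_perm p (by omega) _).trans (h.mergeInputs l hs))
        (length_merged h1 hc h2 hb) h3
      have h7 := (h.mergeInputs l hs).length_eq
      rw [List.length_map] at h7
      have h8 := merge_cost (by omega) hf (hu l) (e.trans_lt h1) (h.forall_length h2)
        (hs'.trans hb) h7 (by rw [List.length_append]; omega) hu0
      change _ + _ + (p.B : ℝ) * ((mergeFiles p (mergeInputs p l lv s)).2 + filterScan p l +
        (arrive p (l + 1) rest (mergeFiles p (mergeInputs p l lv s)).1).2 : ℕ) ≤ _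
      simp only [credit, List.flatten_nil, List.length_nil, Nat.cast_zero, mul_zero, zero_add]
      rw [Nat.cast_add, mul_add]
      refine le_trans ?_ h6
      simp only [List.length_append, Nat.cast_add, Nat.cast_one] at h8 ⊢
      -- A run merged on arrival is never placed on this level, so the arrival weight of its entries
      -- is left over.
      have h9 : 0 ≤ placeWeight p u * b.length := by positivity
      simp only [mergeInputs] at h8 ⊢
      linarith

theorem insertAll_cost_le_credit {p : Params} {u : ℝ} (hB : 1 ≤ p.B) (hlam : 2 ≤ p.lam)
    (hf : 2 ≤ fanIn p) (hu0 : 0 ≤ u)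
    (hu : ∀ l, (p.B : ℝ) * filterScan p l ≤ u * (p.B * p.lam ^ l : ℕ))
    (xs : List (Fingerprint p × V)) :
    (p.B : ℝ) * (insertAll p xs).2 ≤
      credit (placeWeight p u) (mergeWeight p u) 0 (insertItems p.B p.lam xs).2 := by
  induction xs using List.reverseRecOn with
  | nil => simp [insertAll, insertItems, credit]
  | append_singleton xs x ih =>
    rw [insertItems_append_singleton, insertAll_append_singleton]
    have hsim := insertAll_sim id (by omega : 1 ≤ fanIn p) xs
    obtain ⟨h1, h2, -, -⟩ := insertItems_spec hB hlam xs
    rw [List.map_id] at hsim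
    generalize insertItems p.B p.lam xs = a at *
    generalize insertAll p xs = t at *
    have e : t.1.buffer.length = a.1.length := by rw [hsim.1, List.length_map]
    unfold BOA.insert insertItem
    rw [e]
    split_ifs with hc
    · simpa using ih
    · have hb : (x :: a.1).length = p.B * p.lam ^ 0 := by
        rw [List.length_cons, pow_zero, Nat.mul_one]
        omega
      have h3 := arrive_cost hlam hf hu0 hu 0 hsim.2 (mergeSort_perm_map hsim.1 x) hb h2
      have h4 := mul_transfers_zero_le p.B ((x :: t.1.buffer).mergeSort (le p)).length
      rw [List.length_mergeSort, List.length_cons, e, ← List.length_cons (a := x), hb, pow_zero,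
        mul_one] at h4
      have h5 : (p.B : ℝ) * transfers p.B 0 p.B ≤ 2 * p.B := by
        exact_mod_cast (by omega : p.B * transfers p.B 0 p.B ≤ 2 * p.B)
      rw [hb] at h3
      simp only [id_eq, Nat.cast_zero, zero_mul, add_zero, pow_zero, mul_one] at h3
      have h6 : ((x :: t.1.buffer).mergeSort (le p)).length = p.B := by
        rw [List.length_mergeSort, List.length_cons, e, ← List.length_cons (a := x), hb, pow_zero,
          mul_one]
      simp only [h6, Nat.cast_add]
      linarith

/-! ### Logarithms and the total insertion cost -/

/-- Rounding up costs one pass per level, the term `logb lam N`; the rest is `log_lam N * log_f lam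
= log_f N`. -/
theorem log_mul_clog_le {f lam N : ℕ} (hf : 2 ≤ f) (hlam : 2 ≤ lam) :
    (Nat.log lam N : ℝ) * Nat.clog f lam ≤
      Real.logb lam N + Real.log N / Real.log f := by
  have hlf : 0 < Real.log f := Real.log_pos (by exact_mod_cast (by omega : 1 < f))
  have hll : 0 < Real.log lam := Real.log_pos (by exact_mod_cast (by omega : 1 < lam))
  have h1 : (Nat.log lam N : ℝ) ≤ Real.logb lam N := Real.natLog_le_logb _ _
  have h2 : (Nat.clog f lam : ℝ) ≤ 1 + Real.log lam / Real.log f := by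
    have h := Nat.pow_pred_clog_lt_self (b := f) (by omega) (x := lam) (by omega)
    have h3 : Real.log ((f : ℝ) ^ (Nat.clog f lam).pred) ≤ Real.log lam := by
      apply Real.log_le_log
      · have : (0 : ℝ) < f := by exact_mod_cast (by omega : 0 < f)
        positivity
      · exact_mod_cast h.le
    rw [Real.log_pow, ← le_div_iff₀ hlf] at h3
    have h4 : (Nat.clog f lam : ℝ) ≤ ((Nat.clog f lam).pred : ℝ) + 1 := by
      exact_mod_cast (by rw [Nat.pred_eq_sub_one]; omega :
        Nat.clog f lam ≤ (Nat.clog f lam).pred + 1)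
    linarith
  have h5 : 0 ≤ Real.log lam / Real.log f := by positivity
  calc (Nat.log lam N : ℝ) * Nat.clog f lam
      ≤ Real.logb lam N * (1 + Real.log lam / Real.log f) :=
        mul_le_mul h1 h2 (by positivity) ((Nat.cast_nonneg _).trans h1)
    _ = _ := by
        unfold Real.logb
        field_simp

theorem two_le_fanIn {p : Params} (hB : 1 ≤ p.B) (hM : 3 * p.B ≤ p.M) : 2 ≤ fanIn p := by
  have : 3 ≤ p.M / p.B := (Nat.le_div_iff_mul_le hB).2 hM
  unfold fanIn
  omega

theorem log_div_log_fanIn_le {p : Params} (hB : 1 ≤ p.B) (hM : 3 * p.B ≤ p.M) :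
    Real.log p.N / Real.log (fanIn p) ≤ 2 * Real.logb (p.M / p.B) p.N := by
  have hf := two_le_fanIn hB hM
  have hB' : (0 : ℝ) < p.B := by exact_mod_cast hB
  have hlf : 0 < Real.log (fanIn p) := Real.log_pos (by exact_mod_cast (by omega : 1 < fanIn p))
  have hM3 : (3 : ℝ) ≤ p.M / p.B := by
    rw [le_div_iff₀ hB']
    exact_mod_cast hM
  have hlM : 0 < Real.log (p.M / p.B) := Real.log_pos (by linarith)
  have h1 : (p.M : ℝ) / p.B ≤ (fanIn p : ℝ) ^ 2 := by
    rw [div_le_iff₀ hB']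
    have h2 : p.M ≤ (fanIn p + 2) * p.B := by
      have h3 := Nat.lt_mul_div_succ p.M hB
      have h4 : p.M / p.B + 1 = fanIn p + 2 := by unfold fanIn at hf ⊢; omega
      rw [h4, Nat.mul_comm] at h3
      exact h3.le
    -- This is where a fan-in of at least `2`, hence `3 * B ≤ M`, is needed; the square becomes the
    -- factor `2`.
    have h5 : fanIn p + 2 ≤ fanIn p ^ 2 := by nlinarith
    exact_mod_cast h2.trans (Nat.mul_le_mul_right _ h5)
  have h6 : Real.log (p.M / p.B) ≤ 2 * Real.log (fanIn p) := by
    have := Real.log_le_log (by linarith) h1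
    rwa [Real.log_pow] at this
  have h7 : 0 ≤ Real.log p.N := Real.log_natCast_nonneg _
  unfold Real.logb
  rw [← mul_div_assoc, div_le_div_iff₀ hlf hlM]
  nlinarith

theorem insertAll_cost {p : Params} {β : ℝ} (hβ : IsRoutingTableRatio p β) (hB : 1 ≤ p.B)
    (hlam : 2 ≤ p.lam) (hN : p.lam ≤ p.N) (hM : 3 * p.B ≤ p.M)
    {xs : List (Fingerprint p × V)} (hxs : xs.length ≤ p.N) :
    (p.B : ℝ) * (insertAll p xs).2 ≤ xs.length * ((14 + 8 * (p.slack + 3)) *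
      (β + Real.logb (p.M / p.B) p.N + Real.logb p.lam p.N)) := by
  have hf := two_le_fanIn hB hM
  have hβ0 := hβ.pos (by omega)
  have hg : 1 ≤ Nat.log p.lam p.N := Nat.log_pos (by omega) hN
  have hu := filterScan_le hβ hB hlam hN
  have hm := log_mul_clog_le (N := p.N) hf hlam
  have hm' := log_div_log_fanIn_le hB hM
  have hL : (Nat.log p.lam p.N : ℝ) ≤ Real.logb p.lam p.N := Real.natLog_le_logb _ _
  have hlen := length_levels_le hB hlam hxs
  have hcount : (insertItems p.B p.lam xs).2.flatten.flatten.length ≤ xs.length := by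
    have := (insertItems_spec hB hlam xs).2.2.1.length_eq
    rw [List.length_append] at this
    omega
  set g := Nat.log p.lam p.N with hgdef
  have hg' : (1 : ℝ) ≤ g := by exact_mod_cast hg
  have hu0 : 0 ≤ β / g + 1 := by positivity
  have h1 := insertAll_cost_le_credit hB hlam hf hu0 hu xs
  have hp : 0 ≤ placeWeight p (β / g + 1) := by unfold placeWeight; positivity
  have hq : 0 ≤ mergeWeight p (β / g + 1) := by unfold mergeWeight; positivity
  have h2 := credit_le hp hq 0 (insertItems p.B p.lam xs).2
  refine (h1.trans h2).trans ?_
  rw [mul_comm]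
  -- There are at most `g + 1` levels, and `1 ≤ g` because `lam ≤ N`.
  have h3 : ((0 + (insertItems p.B p.lam xs).2.length : ℕ) : ℝ) ≤ 2 * g := by
    exact_mod_cast (by omega : 0 + (insertItems p.B p.lam xs).2.length ≤ 2 * g)
  refine mul_le_mul (by exact_mod_cast hcount) ?_ (by positivity) (by positivity)
  -- The four filter scans per level contribute `2 * g * 4 * (β / g + 1) = 8 * β + 8 * g`: the
  -- number of levels cancels against the packing.
  have h4 : 2 * (g : ℝ) * (placeWeight p (β / g + 1) + mergeWeight p (β / g + 1)) =
      2 * g * (p.slack + 3 + 2 + 4) + 8 * β +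
        4 * (p.slack + 3) * (g * Nat.clog (fanIn p) p.lam) := by
    unfold placeWeight mergeWeight
    push_cast
    field_simp
    ring
  have h5 := mul_le_mul_of_nonneg_right h3 (add_nonneg hp hq)
  have h6 : (g : ℝ) * Nat.clog (fanIn p) p.lam ≤
      Real.logb p.lam p.N + 2 * Real.logb (p.M / p.B) p.N := hm.trans (by linarith)
  have h7 := mul_le_mul_of_nonneg_left h6 (by positivity : (0 : ℝ) ≤ 4 * (p.slack + 3))
  have h8 : 2 * (g : ℝ) * (p.slack + 3 + 2 + 4) ≤
      2 * Real.logb p.lam p.N * (p.slack + 3 + 2 + 4) := by gcongr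
  have h9 : 0 ≤ Real.logb (p.M / p.B) p.N := by
    have : 0 ≤ Real.log p.N / Real.log (fanIn p) := by
      have h := Real.log_natCast_nonneg (fanIn p)
      have h' := Real.log_natCast_nonneg p.N
      positivity
    linarith
  have h10 : 0 ≤ (p.slack : ℝ) * Real.logb p.lam p.N :=
    mul_nonneg (Nat.cast_nonneg _) (by linarith)
  have h11 : 0 ≤ (p.slack : ℝ) * β := by positivity
  linarith

/-! ### Query cost -/

/-- Run number `j` contains a fingerprint with prefix `i`. -/
def RunHas (p : Params) (l : ℕ) (runs : List (List (Entry p V))) (j i : ℕ) : Prop :=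
  1 ≤ j ∧ ∃ r, runs[j - 1]? = some r ∧ ∃ e ∈ r, prefixOf p l e.fp = i

/-- The routing filter and the previous fields lead only to runs with a fingerprint of the same
prefix, and the previous fields lead backwards. -/
def Level.Chained (p : Params) (l : ℕ) (lv : Level p V) : Prop :=
  (∀ i, lv.filter i ≠ 0 → RunHas p l lv.runs (lv.filter i) i) ∧
    ∀ k r, lv.runs[k]? = some r → ∀ e ∈ r, e.prev = k + 1 ∨
      e.prev ≤ k ∧ RunHas p l lv.runs e.prev (prefixOf p l e.fp)

theorem RunHas.append {p : Params} {l : ℕ} {runs : List (List (Entry p V))} {j i : ℕ}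
    (h : RunHas p l runs j i) (r : List (Entry p V)) : RunHas p l (runs ++ [r]) j i := by
  obtain ⟨hj, s, hs, he⟩ := h
  refine ⟨hj, s, ?_, he⟩
  rw [List.getElem?_append_left (List.getElem?_eq_some_iff.1 hs).1, hs]

theorem RunHas.le_length {p : Params} {l : ℕ} {runs : List (List (Entry p V))} {j i : ℕ}
    (h : RunHas p l runs j i) : j ≤ runs.length := by
  obtain ⟨hj, s, hs, -⟩ := h
  have := (List.getElem?_eq_some_iff.1 hs).1
  omega

theorem chained_blank (p : Params) (l : ℕ) : (Level.blank p V).Chained p l :=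
  ⟨fun _ h => absurd rfl h, fun k r h => by simp [Level.blank] at h⟩

/-- The previous fields of the new run are copied from the old filter, so the invariant of the
filter becomes that of the previous fields. -/
theorem Level.Chained.place {p : Params} {l : ℕ} {lv : Level p V} (h : lv.Chained p l)
    (s : List (Fingerprint p × V)) : (place p l lv s).1.Chained p l := by
  constructor
  · intro i hi
    simp only [BOA.place] at hi ⊢
    split_ifs at hi ⊢ with hc
    · obtain ⟨x, hx, hxi⟩ := List.any_eq_true.1 hc
      refine ⟨by omega, _, by rw [Nat.add_sub_cancel, List.getElem?_concat_length], ?_⟩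
      exact ⟨_, List.mem_map_of_mem hx, by simpa using hxi⟩
    · exact (h.1 i hi).append _
  · intro k r hk e he
    simp only [BOA.place] at hk ⊢
    rcases Nat.lt_trichotomy k lv.runs.length with hlt | rfl | hgt
    · rw [List.getElem?_append_left hlt] at hk
      exact (h.2 k r hk e he).imp_right fun h' => ⟨h'.1, h'.2.append _⟩
    · rw [List.getElem?_concat_length] at hk
      obtain rfl := Option.some.inj hk
      obtain ⟨x, hx, rfl⟩ := List.mem_map.1 he
      dsimp only
      split_ifs with hc
      · exact Or.inl rfl
      · exact Or.inr ⟨(h.1 _ hc).le_length, (h.1 _ hc).append _⟩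
    · rw [List.getElem?_eq_none (by simp; omega)] at hk
      cases hk

/-- All levels from `l` on are chained. -/
def Chained (p : Params) : ℕ → List (Level p V) → Prop
  | _, [] => True
  | l, lv :: rest => lv.Chained p l ∧ Chained p (l + 1) rest

theorem Chained.arrive {p : Params} (l : ℕ) {lvs : List (Level p V)} (h : Chained p l lvs)
    (s : List (Fingerprint p × V)) : Chained p l (arrive p l lvs s).1 := by
  induction lvs generalizing l s with
  | nil => exact ⟨(chained_blank p l).place s, trivial⟩
  | cons lv rest ih =>
    unfold BOA.arrive
    split_ifs
    · exact ⟨h.1.place s, h.2⟩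
    · exact ⟨chained_blank p l, ih _ h.2 _⟩

theorem chained_insertAll (p : Params) (xs : List (Fingerprint p × V)) :
    Chained p 0 (insertAll p xs).1.levels := by
  induction xs using List.reverseRecOn with
  | nil => trivial
  | append_singleton xs x ih =>
    rw [insertAll_append_singleton]
    unfold BOA.insert
    split_ifs
    · exact ih
    · exact ih.arrive 0 _

/-! ### Query cost for fixed fingerprints -/

open Classical in
/-- A bound on the cost of fetching from a run, if it has a fingerprint with the same prefix
as `K`. -/
def fetchBound (p : Params) (l : ℕ) (K : Fingerprint p) (r : List (Entry p V)) : ℕ :=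
  (if ∃ e ∈ r, prefixOf p l e.fp = prefixOf p l K then p.slack + 3 else 0) +
    if Bucketed p l r then 0 else 2 * p.lam ^ l

theorem fetch_cost_le {p : Params} {l : ℕ} (hB : 1 ≤ p.B) (hlam : 1 ≤ p.lam)
    {r : List (Entry p V)} (hr : r.length = p.B * p.lam ^ l) {K : Fingerprint p}
    (hm : ∃ e ∈ r, prefixOf p l e.fp = prefixOf p l K) :
    (fetch p l r K).2 ≤ fetchBound p l K r := by
  unfold fetch fetchBound
  rw [if_pos hm]
  split_ifs with h
  · have h1 := transfers_le p.B (bucketOf p l K * fullest p l r) (fullest p l r)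
    have h2 : fullest p l r / p.B ≤ p.slack := Nat.div_le_of_le_mul (by
      rw [Nat.mul_comm]; exact h)
    dsimp only
    omega
  · have h1 := transfers_zero_le p.B r.length
    rw [hr, Nat.mul_div_cancel_left _ hB] at h1
    have h2 : 1 ≤ p.lam ^ l := Nat.pow_pos hlam
    dsimp only
    rw [hr]
    omega

theorem mem_of_mem_fetch {p : Params} {l : ℕ} {r : List (Entry p V)} {K : Fingerprint p}
    {e : Entry p V} (h : e ∈ (fetch p l r K).1) : e ∈ r := by
  unfold fetch at h
  split_ifs at h
  · exact (List.mem_filter.1 h).1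
  · exact h

/-- Run numbers strictly decrease along the chain, so each run is charged at most once, and every
visited run has a matching prefix. -/
theorem chase_cost_le {p : Params} {l : ℕ} (hB : 1 ≤ p.B) (hlam : 1 ≤ p.lam) {lv : Level p V}
    (hlv : lv.Chained p l) (hr : ∀ r ∈ lv.runs, r.length = p.B * p.lam ^ l) (K : Fingerprint p)
    (n j : ℕ) (hj : RunHas p l lv.runs j (prefixOf p l K)) :
    (chase p l lv K n j).2 ≤ ((lv.runs.take j).map (fetchBound p l K)).sum := by
  induction n generalizing j with
  | zero => exact Nat.zero_le _
  | succ n ih =>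
    obtain ⟨hj1, r, hrj, hm⟩ := hj
    have h1 := fetch_cost_le hB hlam (hr r (List.mem_of_getElem? hrj)) hm
    obtain ⟨k, rfl⟩ : ∃ k, j = k + 1 := ⟨j - 1, by omega⟩
    rw [Nat.add_sub_cancel] at hrj
    have h2 : ((lv.runs.take (k + 1)).map (fetchBound p l K)).sum =
        ((lv.runs.take k).map (fetchBound p l K)).sum + fetchBound p l K r := by
      rw [List.take_add_one, hrj]
      simp
    unfold chase
    rw [Nat.add_sub_cancel, hrj, h2]
    dsimp only
    split
    · exact h1.trans (Nat.le_add_left _ _)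
    · rename_i e he
      split_ifs with hp
      · exact h1.trans (Nat.le_add_left _ _)
      · have he' := List.mem_filter.1 (List.mem_of_head? he)
        have hpre : prefixOf p l e.fp = prefixOf p l K := by simpa using he'.2
        rcases hlv.2 k r hrj e (mem_of_mem_fetch he'.1) with h3 | ⟨h3, h4⟩
        · exact absurd h3 hp
        · rw [hpre] at h4
          have h5 := ih _ h4
          have h6 : ((lv.runs.take e.prev).map (fetchBound p l K)).sum ≤
              ((lv.runs.take k).map (fetchBound p l K)).sum :=
            (((List.take_sublist_take_left h3).map _).sum_le_sum (by simp))
          dsimp only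
          omega

theorem queryLevel_cost_le {p : Params} {l : ℕ} (hB : 1 ≤ p.B) (hlam : 1 ≤ p.lam)
    {lv : Level p V} (hlv : lv.Chained p l) (hr : ∀ r ∈ lv.runs, r.length = p.B * p.lam ^ l)
    (K : Fingerprint p) :
    (queryLevel p l lv K).2 ≤ 1 + (lv.runs.map (fetchBound p l K)).sum := by
  unfold queryLevel
  dsimp only
  split_ifs with h
  · exact Nat.le_add_right _ _
  · have h1 := chase_cost_le hB hlam hlv hr K lv.runs.length _ (hlv.1 _ h)
    have h2 : ((lv.runs.take (lv.filter (prefixOf p l K))).map (fetchBound p l K)).sum ≤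
        (lv.runs.map (fetchBound p l K)).sum :=
      (((List.take_sublist _ _).map _).sum_le_sum (by simp))
    dsimp only
    omega

/-- A bound on the cost of fetching from a run in terms of its items: the first term counts the
items with the prefix of `K`, and the second one the buckets that are too full. -/
def itemBound (p : Params) (l : ℕ) (K : Fingerprint p) (g : α → Fingerprint p) (a : List α) : ℕ :=
  (p.slack + 3) * (a.map fun x => if prefixOf p l (g x) = prefixOf p l K then 1 else 0).sum +
    2 * p.lam ^ l * ∑ i ∈ Finset.range (p.lam ^ l),
      if p.slack * p.B < a.countP (fun x => bucketOf p l (g x) = i) then 1 else 0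

/-- Each existential is bounded by a count of witnesses. Sums of indicators are what linearity of
expectation can handle. -/
theorem fetchBound_le_itemBound {p : Params} {l : ℕ} {f : α → Fingerprint p × V}
    {r : List (Entry p V)} {a : List α} (h : RunSim p f r a) (K : Fingerprint p) :
    fetchBound p l K r ≤ itemBound p l K (fun x => (f x).1) a := by
  unfold fetchBound itemBound
  have hp : (r.map Entry.fp).Perm (a.map fun x => (f x).1) := by
    simpa [List.map_map, Function.comp_def] using h.map Prod.fst
  refine Nat.add_le_add ?_ ?_
  · split_ifs with hm
    · obtain ⟨e, he, hK⟩ := hm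
      obtain ⟨x, hx, hxe⟩ := List.mem_map.1 (hp.mem_iff.1 (List.mem_map_of_mem he))
      refine Nat.le_mul_of_pos_right _ (Nat.lt_of_lt_of_le Nat.zero_lt_one ?_)
      refine List.single_le_sum (by simp) _ (List.mem_map.2 ⟨x, hx, ?_⟩)
      simp only [hxe, hK, if_true]
    · exact Nat.zero_le _
  · split_ifs with hb
    · exact Nat.zero_le _
    · refine Nat.le_mul_of_pos_right _ ?_
      unfold Bucketed fullest at hb
      rw [not_le, Finset.lt_sup_iff] at hb
      obtain ⟨i, hi, hlt⟩ := hb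
      refine Finset.sum_pos' (fun _ _ => Nat.zero_le _) ⟨i, hi, ?_⟩
      have e : (r.countP fun e => bucketOf p l e.fp = i) =
          a.countP fun x => bucketOf p l (f x).1 = i := by
        have := hp.countP_eq fun K => decide (bucketOf p l K = i)
        simpa [List.countP_map, Function.comp_def] using this
      rw [if_pos (e ▸ hlt)]
      exact Nat.zero_lt_one

/-- A bound on the query cost in terms of items. -/
def queryBound (p : Params) (K : Fingerprint p) (g : α → Fingerprint p) :
    ℕ → List (List (List α)) → ℕ
  | _, [] => 0
  | l, lv :: rest => 1 + (lv.map (itemBound p l K g)).sum + queryBound p K g (l + 1) rest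

theorem queryLevels_cost_le {p : Params} (hB : 1 ≤ p.B) (hlam : 1 ≤ p.lam)
    {f : α → Fingerprint p × V} (l : ℕ) {lvs : List (Level p V)} {as : List (List (List α))}
    (hc : Chained p l lvs) (hs : Sized p.B p.lam l as) (h : List.Forall₂ (LevelSim p f) lvs as)
    (K : Fingerprint p) :
    (queryLevels p K l lvs).2 ≤ queryBound p K (fun x => (f x).1) l as := by
  induction h generalizing l with
  | nil => exact Nat.zero_le _
  | @cons lv a rest as' h h' ih =>
    obtain ⟨-, hs2, hs3⟩ := hs
    have h1 := queryLevel_cost_le hB hlam hc.1 (h.forall_length hs2) K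
    have h2 : (lv.runs.map (fetchBound p l K)).sum ≤
        (a.map (itemBound p l K fun x => (f x).1)).sum := by
      unfold LevelSim at h
      generalize lv.runs = rs at h
      clear hs2
      induction h with
      | nil => simp
      | cons h _ ih =>
        simp only [List.map_cons, List.sum_cons]
        exact Nat.add_le_add (fetchBound_le_itemBound h K) ih
    have h3 := ih (l + 1) hc.2 hs3
    simp only [queryLevels, queryBound]
    omega

theorem query_cost_le {p : Params} (hB : 1 ≤ p.B) (hlam : 2 ≤ p.lam) (hM : 3 * p.B ≤ p.M)
    (f : α → Fingerprint p × V) (xs : List α) (K : Fingerprint p) :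
    (query p (insertAll p (xs.map f)).1 K).2 ≤
      queryBound p K (fun x => (f x).1) 0 (insertItems p.B p.lam xs).2 := by
  have hf := two_le_fanIn hB hM
  exact queryLevels_cost_le hB (by omega) 0 (chained_insertAll p _)
    (insertItems_spec hB hlam xs).2.1 (insertAll_sim f (by omega) xs).2 K

variable {κ Ω : Type*} [MeasurableSpace Ω]

open MeasureTheory ProbabilityTheory

/-! ### Hash values -/

theorem card_le_of_forall_lt_add {U : ℕ} {s : Finset (Fin U)} {w : ℕ}
    (h : ∀ x ∈ s, ∀ y ∈ s, y.val < x.val + w) : s.card ≤ w := by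
  rcases s.eq_empty_or_nonempty with rfl | hs
  · simp
  · have h1 : s.map Fin.valEmbedding ⊆
        Finset.Ico (s.min' hs).val ((s.min' hs).val + w) := by
      intro y hy
      obtain ⟨z, hz, rfl⟩ := Finset.mem_map.1 hy
      exact Finset.mem_Ico.2 ⟨s.min'_le z hz, h _ (s.min'_mem hs) _ hz⟩
    simpa using Finset.card_le_card h1

theorem lt_add_of_div_eq {d a b : ℕ} (hd : 1 ≤ d) (h : a / d = b / d) : b < a + d := by
  have h1 := Nat.lt_mul_div_succ b hd
  have h2 := Nat.mul_div_le a d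
  rw [← h, Nat.mul_succ] at h1
  omega

/-- The summand `1` matters for `l > len`, where the quotient is `0` but a bucket may still hold one
fingerprint. -/
theorem card_filter_bucketOf_le (p : Params) (l i : ℕ) (hlam : 1 ≤ p.lam) :
    (Finset.univ.filter fun K : Fingerprint p => bucketOf p l K = i).card ≤
      p.lam ^ p.len / p.lam ^ l + 1 := by
  refine card_le_of_forall_lt_add fun x hx y hy => ?_
  have hx := (Finset.mem_filter.1 hx).2
  have hy := (Finset.mem_filter.1 hy).2
  have h1 := lt_add_of_div_eq (Nat.pow_pos hlam) (hx.trans hy.symm)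
  have h2 : y.val - x.val ≤ p.lam ^ p.len / p.lam ^ l := by
    rw [Nat.le_div_iff_mul_le (Nat.pow_pos hlam), Nat.sub_mul]
    omega
  omega

theorem card_filter_prefixOf_le (p : Params) (l v : ℕ) (hlam : 1 ≤ p.lam) :
    (Finset.univ.filter fun K : Fingerprint p => prefixOf p l K = v).card ≤
      p.lam ^ (p.len - p.h l) := by
  refine card_le_of_forall_lt_add fun x hx y hy => ?_
  have hx := (Finset.mem_filter.1 hx).2
  have hy := (Finset.mem_filter.1 hy).2
  exact lt_add_of_div_eq (Nat.pow_pos hlam) (hx.trans hy.symm)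

/-! ### Probabilities under a k-wise independent hash function -/

variable {μ : Measure Ω} {k U : ℕ}

theorem IsKWiseIndependent.measure_preimage {H : κ → Ω → Fin U}
    (hH : IsKWiseIndependent μ k U H) (x : κ) (s : Finset (Fin U)) :
    μ (H x ⁻¹' s) = s.card * (U : ENNReal)⁻¹ := by
  rw [← sum_measure_preimage_singleton s fun y _ => hH.measurable x (measurableSet_singleton y)]
  simp [hH.uniform]

theorem natCast_mul_inv_le_ofReal {a b : ℕ} {r : ℝ} (hb : 1 ≤ b) (h : (a : ℝ) / b ≤ r) :
    (a : ENNReal) * (b : ENNReal)⁻¹ ≤ ENNReal.ofReal r := by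
  refine le_trans (le_of_eq ?_) (ENNReal.ofReal_le_ofReal h)
  rw [ENNReal.ofReal_div_of_pos (by exact_mod_cast hb), ENNReal.ofReal_natCast,
    ENNReal.ofReal_natCast, div_eq_mul_inv]

theorem measure_bucketOf_le {p : Params} (hlam : 1 ≤ p.lam) {H : κ → Ω → Fingerprint p}
    (hH : IsKWiseIndependent μ k (p.lam ^ p.len) H) (l i : ℕ) (x : κ) :
    μ {ω | bucketOf p l (H x ω) = i} ≤
      ENNReal.ofReal (1 / (p.lam : ℝ) ^ l + 1 / (p.lam : ℝ) ^ p.len) := by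
  have h1 := hH.measure_preimage x
    (Finset.univ.filter fun K : Fingerprint p => bucketOf p l K = i)
  have e : {ω | bucketOf p l (H x ω) = i} = H x ⁻¹'
      ((Finset.univ.filter fun K : Fingerprint p => bucketOf p l K = i) : Finset _) := by
    ext ω
    simp
  rw [e, h1]
  refine natCast_mul_inv_le_ofReal (Nat.pow_pos hlam) ?_
  have hl : (0 : ℝ) < p.lam := by exact_mod_cast hlam
  have h2 : ((Finset.univ.filter fun K : Fingerprint p => bucketOf p l K = i).card : ℝ) ≤
      (p.lam : ℝ) ^ p.len / (p.lam : ℝ) ^ l + 1 := by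
    have h3 : ((p.lam ^ p.len / p.lam ^ l : ℕ) : ℝ) ≤
      ((p.lam ^ p.len : ℕ) : ℝ) / ((p.lam ^ l : ℕ) : ℝ) := Nat.cast_div_le
    push_cast at h3
    have h4 : ((Finset.univ.filter fun K : Fingerprint p => bucketOf p l K = i).card : ℝ) ≤
        ((p.lam ^ p.len / p.lam ^ l : ℕ) : ℝ) + 1 := by
      exact_mod_cast card_filter_bucketOf_le p l i hlam
    linarith
  push_cast
  rw [div_le_iff₀ (by positivity)]
  refine h2.trans (le_of_eq ?_)
  field_simp

/-- The second summand covers `h l > len`, where the prefix is the whole fingerprint. -/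
theorem measure_prefixOf_le {p : Params} (hlam : 1 ≤ p.lam) {H : κ → Ω → Fingerprint p}
    (hH : IsKWiseIndependent μ k (p.lam ^ p.len) H) (l v : ℕ) (x : κ) :
    μ {ω | prefixOf p l (H x ω) = v} ≤
      ENNReal.ofReal (1 / (p.lam : ℝ) ^ p.h l + 1 / (p.lam : ℝ) ^ p.len) := by
  have h1 := hH.measure_preimage x
    (Finset.univ.filter fun K : Fingerprint p => prefixOf p l K = v)
  have e : {ω | prefixOf p l (H x ω) = v} = H x ⁻¹'
      ((Finset.univ.filter fun K : Fingerprint p => prefixOf p l K = v) : Finset _) := by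
    ext ω
    simp
  rw [e, h1]
  refine natCast_mul_inv_le_ofReal (Nat.pow_pos hlam) ?_
  have hl : (0 : ℝ) < p.lam := by exact_mod_cast hlam
  have h2 : ((Finset.univ.filter fun K : Fingerprint p => prefixOf p l K = v).card : ℝ) ≤
      (p.lam : ℝ) ^ (p.len - p.h l) := by
    exact_mod_cast card_filter_prefixOf_le p l v hlam
  push_cast
  have h3 : (p.lam : ℝ) ^ (p.len - p.h l) ≤
      (1 / (p.lam : ℝ) ^ p.h l + 1 / (p.lam : ℝ) ^ p.len) * (p.lam : ℝ) ^ p.len := by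
    rcases le_total (p.h l) p.len with h | h
    · have e : (p.lam : ℝ) ^ p.len = (p.lam : ℝ) ^ (p.len - p.h l) * (p.lam : ℝ) ^ p.h l := by
        rw [← pow_add, Nat.sub_add_cancel h]
      have h4 : (1 / (p.lam : ℝ) ^ p.h l) * (p.lam : ℝ) ^ p.len =
          (p.lam : ℝ) ^ (p.len - p.h l) := by
        rw [e]
        field_simp
      have h5 : 0 ≤ (1 / (p.lam : ℝ) ^ p.len) * (p.lam : ℝ) ^ p.len := by positivity
      linarith
    · rw [Nat.sub_eq_zero_of_le h, pow_zero, add_mul]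
      have h4 : (1 / (p.lam : ℝ) ^ p.len) * (p.lam : ℝ) ^ p.len = 1 := by field_simp
      have h5 : 0 ≤ (1 / (p.lam : ℝ) ^ p.h l) * (p.lam : ℝ) ^ p.len := by positivity
      linarith
  rw [div_le_iff₀ (by positivity)]
  exact h2.trans h3

theorem IsKWiseIndependent.indepFun {H : κ → Ω → Fin U} (hH : IsKWiseIndependent μ k U H)
    (hk : 2 ≤ k) {x y : κ} (hxy : x ≠ y) : IndepFun (H x) (H y) μ := by
  classical
  have h := hH.indep {x, y} ((Finset.card_insert_le _ _).trans (by simpa using hk))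
  exact h.indepFun (i := ⟨x, by simp⟩) (j := ⟨y, by simp⟩) (by simpa using hxy)

/-- Splitting by the value of `H q` turns the collision into a fixed target for `H x`; only pairwise
independence is used. -/
theorem measure_prefixOf_eq_le {p : Params} (hlam : 1 ≤ p.lam) {H : κ → Ω → Fingerprint p}
    (hH : IsKWiseIndependent μ k (p.lam ^ p.len) H) (hk : 2 ≤ k) (l : ℕ) {x q : κ}
    (hxq : x ≠ q) :
    μ {ω | prefixOf p l (H x ω) = prefixOf p l (H q ω)} ≤
      ENNReal.ofReal (1 / (p.lam : ℝ) ^ p.h l + 1 / (p.lam : ℝ) ^ p.len) := by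
  set b := ENNReal.ofReal (1 / (p.lam : ℝ) ^ p.h l + 1 / (p.lam : ℝ) ^ p.len) with hb
  have h1 : {ω | prefixOf p l (H x ω) = prefixOf p l (H q ω)} ⊆
      ⋃ v : Fingerprint p, H x ⁻¹' {K | prefixOf p l K = prefixOf p l v} ∩ H q ⁻¹' {v} := by
    intro ω hω
    exact Set.mem_iUnion.2 ⟨H q ω, hω, rfl⟩
  refine (measure_mono h1).trans ((measure_iUnion_fintype_le _ _).trans ?_)
  have h2 : ∀ v : Fingerprint p,
      μ (H x ⁻¹' {K | prefixOf p l K = prefixOf p l v} ∩ H q ⁻¹' {v}) ≤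
        b * ((p.lam ^ p.len : ℕ) : ENNReal)⁻¹ := by
    intro v
    rw [(hH.indepFun hk hxq).measure_inter_preimage_eq_mul _ _ .of_discrete .of_discrete,
      hH.uniform]
    exact mul_le_mul_left (measure_prefixOf_le hlam hH l _ x) _
  refine (Finset.sum_le_sum fun v _ => h2 v).trans (le_of_eq ?_)
  have hU : ((p.lam ^ p.len : ℕ) : ENNReal) ≠ 0 := by
    exact_mod_cast (Nat.pow_pos hlam).ne'
  rw [Finset.sum_const, Finset.card_univ, Fintype.card_fin, nsmul_eq_mul, mul_left_comm,
    ENNReal.mul_inv_cancel hU (ENNReal.natCast_ne_top _), mul_one]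

/-! ### Tail bound for the load of a bucket -/

-- Markov's inequality for the number of `j`-subsets of `s` all of whose events occur: if more than
-- `t` events occur, there are at least `(t + 1).choose j` such subsets. Only intersections of `j`
-- events enter.
open Classical in
theorem choose_mul_measure_card_gt_le {s : Finset κ} {A : κ → Set Ω}
    (hA : ∀ y, MeasurableSet (A y)) {j : ℕ} {b : ENNReal}
    (hb : ∀ J ⊆ s, J.card = j → μ (⋂ y ∈ J, A y) ≤ b) (t : ℕ) :
    ((t + 1).choose j : ENNReal) * μ {ω | t < (s.filter fun y => ω ∈ A y).card} ≤
      s.card.choose j * b := by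
  have hm : ∀ J : Finset κ, MeasurableSet (⋂ y ∈ J, A y) :=
    fun J => J.measurableSet_biInter fun y _ => hA y
  calc ((t + 1).choose j : ENNReal) * μ {ω | t < (s.filter fun y => ω ∈ A y).card}
      ≤ ((t + 1).choose j : ENNReal) * μ {ω | ((t + 1).choose j : ENNReal) ≤
          ∑ J ∈ s.powersetCard j, (⋂ y ∈ J, A y).indicator 1 ω} := by
        refine mul_le_mul_right (measure_mono fun ω hω => ?_) _
        have h1 : ∑ J ∈ (s.filter fun y => ω ∈ A y).powersetCard j, (1 : ENNReal) ≤
            ∑ J ∈ s.powersetCard j, (⋂ y ∈ J, A y).indicator 1 ω := by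
          refine (Finset.sum_le_sum fun J hJ => ?_).trans (Finset.sum_le_sum_of_subset
            (Finset.powersetCard_mono (Finset.filter_subset _ s)))
          rw [Set.indicator_of_mem]
          · rfl
          · refine Set.mem_iInter₂.2 fun y hy => ?_
            exact (Finset.mem_filter.1 ((Finset.mem_powersetCard.1 hJ).1 hy)).2
        refine le_trans ?_ h1
        rw [Finset.sum_const, Finset.card_powersetCard, nsmul_eq_mul, mul_one]
        exact_mod_cast Nat.choose_le_choose j hω
    _ ≤ ∫⁻ ω, ∑ J ∈ s.powersetCard j, (⋂ y ∈ J, A y).indicator 1 ω ∂μ :=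
        mul_meas_ge_le_lintegral
          (Finset.measurable_fun_sum _ fun J _ => measurable_one.indicator (hm J)) _
    _ = ∑ J ∈ s.powersetCard j, μ (⋂ y ∈ J, A y) := by
        rw [lintegral_finsetSum _ fun J _ => measurable_one.indicator (hm J)]
        exact Finset.sum_congr rfl fun J _ => lintegral_indicator_one (hm J)
    _ ≤ ∑ J ∈ s.powersetCard j, b := Finset.sum_le_sum fun J hJ =>
        hb J (Finset.mem_powersetCard.1 hJ).1 (Finset.mem_powersetCard.1 hJ).2
    _ = _ := by rw [Finset.sum_const, Finset.card_powersetCard, nsmul_eq_mul]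

theorem IsKWiseIndependent.measure_biInter_le {H : κ → Ω → Fin U}
    (hH : IsKWiseIndependent μ k U H) {J : Finset κ} (hJ : J.card ≤ k) {S : Set (Fin U)}
    {b : ENNReal} (hb : ∀ x, μ (H x ⁻¹' S) ≤ b) : μ (⋂ y ∈ J, H y ⁻¹' S) ≤ b ^ J.card := by
  have h := (hH.indep J hJ).measure_inter_preimage_eq_mul Finset.univ
    (sets := fun _ => S) fun _ _ => .of_discrete
  have e : (⋂ y ∈ J, H y ⁻¹' S) = ⋂ y ∈ (Finset.univ : Finset J), H y ⁻¹' S := by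
    ext ω
    simp
  rw [e, h]
  refine (Finset.prod_le_prod' fun (y : J) _ => hb y).trans (le_of_eq ?_)
  simp

/-- The choice of `a` makes the base at most `exp (-2 / c)`, and the exponent is at least `c * log
N`. -/
theorem tail_ratio_le {c B N nq : ℝ} {a j T : ℕ} (hc : 0 < c) (hN : 1 ≤ N) (hB : 1 ≤ B)
    (ha : (1 + 1 / c) * Real.exp (2 / c) + 1 ≤ a) (hnq0 : 0 ≤ nq) (hnq : nq ≤ B * (1 + 1 / c))
    (hj : c * Real.log N ≤ j) (hT : (a - 1) * B ≤ T) :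
    (nq / T) ^ j ≤ 1 / N ^ 2 := by
  have hE := Real.exp_pos (2 / c)
  have ha0 : 0 < (a : ℝ) - 1 := by
    have : 0 < (1 + 1 / c) * Real.exp (2 / c) := by positivity
    linarith
  have h1 : nq / T ≤ Real.exp (-(2 / c)) := by
    have hT0 : (0 : ℝ) < T := lt_of_lt_of_le (by positivity) hT
    rw [div_le_iff₀ hT0, Real.exp_neg, inv_mul_eq_div, le_div_iff₀ hE]
    calc nq * Real.exp (2 / c) ≤ B * (1 + 1 / c) * Real.exp (2 / c) := by gcongr
      _ = ((1 + 1 / c) * Real.exp (2 / c)) * B := by ring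
      _ ≤ (a - 1) * B := by gcongr; linarith
      _ ≤ T := hT
  calc (nq / T) ^ j ≤ Real.exp (-(2 / c)) ^ j := pow_le_pow_left₀ (by positivity) h1 j
    _ = Real.exp (-(2 / c) * j) := by rw [← Real.exp_nat_mul, mul_comm]
    _ ≤ Real.exp (-(2 * Real.log N)) := by
        apply Real.exp_le_exp.2
        have : 2 / c * (c * Real.log N) ≤ 2 / c * j := by gcongr
        have e : 2 / c * (c * Real.log N) = 2 * Real.log N := by field_simp
        linarith
    _ = 1 / N ^ 2 := by
        rw [Real.exp_neg, one_div, two_mul, Real.exp_add, Real.exp_log (by linarith), sq]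

/-- The moment bound is at most `(n * q / (t + 2 - j)) ^ j`, with `n` items that each hit the bucket
with probability at most `q`. The expected load `n * q` is at most `B * (1 + 1 / c)`, while the
denominator is at least `(slack - 1) * B`. -/
theorem measure_bucket_overflow_le {p : Params} {c : ℝ} (hc : 0 < c) (hB : 1 ≤ p.B)
    (hlam : 1 ≤ p.lam) (hN : 1 ≤ p.N)
    (ha : (1 + 1 / c) * Real.exp (2 / c) + 1 ≤ p.slack) (hcB : c * Real.log p.N ≤ p.B)
    (hcU : c * (p.N : ℝ) ^ 2 ≤ (p.lam : ℝ) ^ p.len) {H : κ → Ω → Fingerprint p}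
    (hH : IsKWiseIndependent μ k (p.lam ^ p.len) H) (hck : c * Real.log p.N ≤ k) (l i : ℕ)
    {s : Finset κ} (hs : s.card = p.B * p.lam ^ l) (hsN : s.card ≤ p.N) :
    μ {ω | p.slack * p.B < (s.filter fun y => bucketOf p l (H y ω) = i).card} ≤
      ENNReal.ofReal (1 / (p.N : ℝ) ^ 2) := by
  have hlam' : (0 : ℝ) < p.lam := by exact_mod_cast hlam
  have hN' : (1 : ℝ) ≤ p.N := by exact_mod_cast hN
  have hB' : (1 : ℝ) ≤ p.B := by exact_mod_cast hB
  -- The order of the moment: large enough for `1 / N ^ 2`, at most `k` for independence, and at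
  -- most `B` so that `t + 2 - j` stays close to `t`.
  set j := ⌈c * Real.log p.N⌉₊ with hj
  have hjk : j ≤ k := Nat.ceil_le.2 hck
  have hjB : j ≤ p.B := Nat.ceil_le.2 hcB
  have hjc : c * Real.log p.N ≤ j := Nat.le_ceil _
  set q : ℝ := 1 / (p.lam : ℝ) ^ l + 1 / (p.lam : ℝ) ^ p.len with hq
  have hq0 : 0 ≤ q := by positivity
  set t := p.slack * p.B with ht
  have hslack : 1 ≤ p.slack := by
    have : 0 < (1 + 1 / c) * Real.exp (2 / c) := by positivity
    exact_mod_cast (by linarith : (1 : ℝ) ≤ p.slack)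
  have hBt : p.B ≤ t := Nat.le_mul_of_pos_left _ hslack
  have h1 := choose_mul_measure_card_gt_le (μ := μ) (s := s)
    (A := fun y => H y ⁻¹' {K | bucketOf p l K = i})
    (fun y => hH.measurable y .of_discrete) (j := j) (b := ENNReal.ofReal q ^ j)
    (fun J _ hJ => by
      have := hH.measure_biInter_le (J := J) (by omega) (S := {K | bucketOf p l K = i})
        (fun x => measure_bucketOf_le hlam hH l i x)
      rwa [hJ] at this) t
  have hnq : (s.card : ℝ) * q ≤ p.B * (1 + 1 / c) := by
    have h2 : (s.card : ℝ) * (1 / (p.lam : ℝ) ^ l) = p.B := by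
      rw [hs]
      push_cast
      field_simp
    have h3 : (s.card : ℝ) * (1 / (p.lam : ℝ) ^ p.len) ≤ 1 / c := by
      rw [mul_one_div, div_le_div_iff₀ (by positivity) hc, one_mul]
      have h4 : (s.card : ℝ) ≤ p.N := by exact_mod_cast hsN
      have h5 : (p.N : ℝ) ≤ (p.N : ℝ) ^ 2 := by nlinarith
      have h6 : (s.card : ℝ) * c ≤ (p.N : ℝ) ^ 2 * c := by
        apply mul_le_mul_of_nonneg_right (h4.trans h5) hc.le
      linarith
    have h7 : 1 / c ≤ p.B * (1 / c) := le_mul_of_one_le_left (by positivity) hB'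
    rw [hq, mul_add, h2]
    linarith
  have hT : ((p.slack : ℝ) - 1) * p.B ≤ ((t + 1 + 1 - j : ℕ) : ℝ) := by
    have h2 : t ≤ (t + 1 + 1 - j) + p.B := by omega
    have h3 : ((t : ℕ) : ℝ) ≤ ((t + 1 + 1 - j : ℕ) : ℝ) + p.B := by exact_mod_cast h2
    rw [ht] at h3 ⊢
    push_cast at h3 ⊢
    linarith
  have h2 := tail_ratio_le hc hN' hB' ha (mul_nonneg (Nat.cast_nonneg _) hq0) hnq hjc hT
  have hT0 : 0 < t + 1 + 1 - j := by omega
  have hT0' : (0 : ℝ) < ((t + 1 + 1 - j : ℕ) : ℝ) := by exact_mod_cast hT0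
  have hch : (0 : ℝ) < (t + 1).choose j := by
    exact_mod_cast Nat.choose_pos (by omega)
  have h3 : (s.card.choose j : ℝ) * q ^ j ≤ 1 / (p.N : ℝ) ^ 2 * (t + 1).choose j := by
    have h4 : (s.card.choose j : ℝ) ≤ (s.card : ℝ) ^ j / (j.factorial : ℝ) :=
      Nat.choose_le_pow_div _ _
    have h5 : ((t + 1 + 1 - j : ℕ) : ℝ) ^ j / (j.factorial : ℝ) ≤ (t + 1).choose j :=
      Nat.pow_le_choose _ _
    calc (s.card.choose j : ℝ) * q ^ j ≤ (s.card : ℝ) ^ j / (j.factorial : ℝ) * q ^ j := by gcongr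
      _ = (s.card * q / ((t + 1 + 1 - j : ℕ) : ℝ)) ^ j *
          (((t + 1 + 1 - j : ℕ) : ℝ) ^ j / (j.factorial : ℝ)) := by
        rw [div_pow, mul_pow]
        field_simp
      _ ≤ _ := by gcongr
  have h4 : (s.card.choose j : ENNReal) * ENNReal.ofReal q ^ j ≤
      ((t + 1).choose j : ENNReal) * ENNReal.ofReal (1 / (p.N : ℝ) ^ 2) := by
    have h5 := ENNReal.ofReal_le_ofReal h3
    rwa [ENNReal.ofReal_mul (by positivity), ENNReal.ofReal_mul (by positivity),
      ENNReal.ofReal_natCast, ENNReal.ofReal_natCast, ENNReal.ofReal_pow hq0, mul_comm _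
      (((t + 1).choose j : ℕ) : ENNReal)] at h5
  have hch' : ((t + 1).choose j : ENNReal) ≠ 0 := by exact_mod_cast hch.ne'
  refine (ENNReal.mul_le_mul_iff_right hch' (ENNReal.natCast_ne_top _)).1 (le_trans ?_ h4)
  refine le_trans (le_of_eq ?_) h1
  congr 2
  ext ω
  refine iff_of_eq (congrArg (t < ·) (congrArg Finset.card ?_))
  ext y
  simp

/-! ### Expected query cost -/

theorem measurable_list_sum_map {ι : Type*} {F : ι → Ω → ENNReal} (hF : ∀ x, Measurable (F x))
    (a : List ι) : Measurable fun ω => (a.map fun x => F x ω).sum := by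
  induction a with
  | nil => simp
  | cons x a ih =>
    simp only [List.map_cons, List.sum_cons]
    exact (hF x).add ih

theorem lintegral_list_sum_map {ι : Type*} {F : ι → Ω → ENNReal} (hF : ∀ x, Measurable (F x))
    (a : List ι) :
    ∫⁻ ω, (a.map fun x => F x ω).sum ∂μ = (a.map fun x => ∫⁻ ω, F x ω ∂μ).sum := by
  induction a with
  | nil => simp
  | cons x a ih =>
    simp only [List.map_cons, List.sum_cons]
    rw [lintegral_add_left (hF x), ih]

theorem measurable_ite_one_zero {P : Ω → Prop} [DecidablePred P]
    (hP : MeasurableSet {ω | P ω}) : Measurable fun ω => if P ω then (1 : ENNReal) else 0 :=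
  Measurable.ite hP measurable_const measurable_const

theorem lintegral_ite_one_zero {P : Ω → Prop} [DecidablePred P]
    (hP : MeasurableSet {ω | P ω}) :
    ∫⁻ ω, (if P ω then (1 : ENNReal) else 0) ∂μ = μ {ω | P ω} := by
  rw [← lintegral_indicator_one hP]
  refine lintegral_congr fun ω => ?_
  simp [Set.indicator_apply]

theorem measurableSet_prefixOf_eq {p : Params} {H : κ → Ω → Fingerprint p}
    (hH : IsKWiseIndependent μ k (p.lam ^ p.len) H) (l : ℕ) (x q : κ) :
    MeasurableSet {ω | prefixOf p l (H x ω) = prefixOf p l (H q ω)} := by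
  have h : ∀ x, Measurable fun ω => prefixOf p l (H x ω) := fun x =>
    (Measurable.of_discrete (f := prefixOf p l)).comp (hH.measurable x)
  exact measurableSet_eq_fun (h x) (h q)

theorem measurableSet_overflow {p : Params} {H : κ → Ω → Fingerprint p}
    (hH : IsKWiseIndependent μ k (p.lam ^ p.len) H) (l i t : ℕ) (a : List (κ × V)) :
    MeasurableSet {ω | t < a.countP fun x => bucketOf p l (H x.1 ω) = i} := by
  have h : Measurable fun ω => a.countP fun x => bucketOf p l (H x.1 ω) = i := by
    induction a with
    | nil => simp
    | cons x a ih =>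
      simp only [List.countP_cons]
      refine ih.add (Measurable.ite ?_ measurable_const measurable_const)
      have h' : Measurable fun ω => bucketOf p l (H x.1 ω) :=
        (Measurable.of_discrete (f := bucketOf p l)).comp (hH.measurable x.1)
      simp only [decide_eq_true_eq]
      exact h' (measurableSet_singleton i)
  exact measurableSet_lt measurable_const h

theorem countP_eq_card_filter [DecidableEq κ] {a : List (κ × V)} (ha : (a.map Prod.fst).Nodup)
    (P : κ → Prop) [DecidablePred P] :
    (a.countP fun x => P x.1) = ((a.map Prod.fst).toFinset.filter P).card := by
  have e : (a.map Prod.fst).toFinset.filter P =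
      ((a.map Prod.fst).filter fun x => P x).toFinset := by
    ext x
    simp
  rw [e, List.toFinset_card_of_nodup (ha.filter _), ← List.countP_eq_length_filter,
    List.countP_map]
  rfl

omit [MeasurableSpace Ω] in
/-- The terms of `itemBound` for a random hash function. -/
theorem coe_itemBound {p : Params} (H : κ → Ω → Fingerprint p) (l : ℕ) (q : κ) (a : List (κ × V))
    (ω : Ω) : (itemBound p l (H q ω) (fun x => H x.1 ω) a : ENNReal) =
      ((p.slack + 3 : ℕ) : ENNReal) * (a.map fun x =>
        if prefixOf p l (H x.1 ω) = prefixOf p l (H q ω) then (1 : ENNReal) else 0).sum +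
      ((2 * p.lam ^ l : ℕ) : ENNReal) * ∑ i ∈ Finset.range (p.lam ^ l),
        if p.slack * p.B < a.countP (fun x => bucketOf p l (H x.1 ω) = i)
        then (1 : ENNReal) else 0 := by
  unfold itemBound
  push_cast
  simp [List.map_map, Function.comp_def]

theorem measurable_itemBound {p : Params} {H : κ → Ω → Fingerprint p}
    (hH : IsKWiseIndependent μ k (p.lam ^ p.len) H) (l : ℕ) (q : κ) (a : List (κ × V)) :
    Measurable fun ω => (itemBound p l (H q ω) (fun x => H x.1 ω) a : ENNReal) := by
  simp only [coe_itemBound]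
  refine ((measurable_list_sum_map (F := fun (x : κ × V) ω =>
    if prefixOf p l (H x.1 ω) = prefixOf p l (H q ω) then (1 : ENNReal) else 0) (fun x => ?_)
      a).const_mul _).add ((Finset.measurable_fun_sum _ fun i _ => ?_).const_mul _)
  · exact measurable_ite_one_zero (measurableSet_prefixOf_eq hH l x.1 q)
  · exact measurable_ite_one_zero (measurableSet_overflow hH l i _ a)

open Classical in
-- The key `q` collides with itself with certainty, hence the separate count; any other key is
-- covered by the collision bound.
theorem sum_lintegral_prefixOf_eq_le [IsProbabilityMeasure μ] {p : Params}
    {H : κ → Ω → Fingerprint p} (hlam : 1 ≤ p.lam)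
    (hH : IsKWiseIndependent μ k (p.lam ^ p.len) H) (hk : 2 ≤ k) (l : ℕ) (q : κ)
    (a : List (κ × V)) :
    (a.map fun x => ∫⁻ ω, (if prefixOf p l (H x.1 ω) = prefixOf p l (H q ω)
        then (1 : ENNReal) else 0) ∂μ).sum ≤
      (a.map Prod.fst).count q + a.length *
        ENNReal.ofReal (1 / (p.lam : ℝ) ^ p.h l + 1 / (p.lam : ℝ) ^ p.len) := by
  induction a with
  | nil => simp
  | cons x a ih =>
    simp only [List.map_cons, List.sum_cons, List.count_cons, List.length_cons]
    have h1 : ∫⁻ ω, (if prefixOf p l (H x.1 ω) = prefixOf p l (H q ω) then (1 : ENNReal)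
        else 0) ∂μ ≤ ((if x.1 == q then 1 else 0 : ℕ) : ENNReal) +
          ENNReal.ofReal (1 / (p.lam : ℝ) ^ p.h l + 1 / (p.lam : ℝ) ^ p.len) := by
      rw [lintegral_ite_one_zero (measurableSet_prefixOf_eq hH l x.1 q)]
      by_cases hx : x.1 = q
      · rw [if_pos (by simpa using hx)]
        exact prob_le_one.trans (by simp)
      · exact (measure_prefixOf_eq_le hlam hH hk l hx).trans le_add_self
    refine (add_le_add h1 ih).trans (le_of_eq ?_)
    rw [Nat.cast_add, Nat.cast_add, Nat.cast_one]
    ring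

open Classical in
theorem lintegral_itemBound_le [IsProbabilityMeasure μ] {p : Params} {H : κ → Ω → Fingerprint p}
    (hlam : 1 ≤ p.lam) (hH : IsKWiseIndependent μ k (p.lam ^ p.len) H) (hk : 2 ≤ k) (l : ℕ) (q : κ)
    {a : List (κ × V)} {δ : ENNReal}
    (hδ : ∀ i, μ {ω | p.slack * p.B < a.countP fun x => bucketOf p l (H x.1 ω) = i} ≤ δ) :
    ∫⁻ ω, (itemBound p l (H q ω) (fun x => H x.1 ω) a : ENNReal) ∂μ ≤
      ((p.slack + 3 : ℕ) : ENNReal) * ((a.map Prod.fst).count q + a.length *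
        ENNReal.ofReal (1 / (p.lam : ℝ) ^ p.h l + 1 / (p.lam : ℝ) ^ p.len)) +
      ((2 * p.lam ^ l : ℕ) : ENNReal) * (((p.lam ^ l : ℕ) : ENNReal) * δ) := by
  have hm : ∀ x : κ × V, Measurable fun ω =>
      if prefixOf p l (H x.1 ω) = prefixOf p l (H q ω) then (1 : ENNReal) else 0 := fun x =>
    measurable_ite_one_zero (measurableSet_prefixOf_eq hH l x.1 q)
  have hm' : ∀ i, Measurable fun ω =>
      if p.slack * p.B < a.countP (fun x => bucketOf p l (H x.1 ω) = i)
        then (1 : ENNReal) else 0 := fun i =>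
    measurable_ite_one_zero (measurableSet_overflow hH l i _ a)
  simp only [coe_itemBound]
  rw [lintegral_add_left ((measurable_list_sum_map hm a).const_mul _),
    lintegral_const_mul _ (measurable_list_sum_map hm a),
    lintegral_const_mul _ (Finset.measurable_fun_sum _ fun i _ => hm' i),
    lintegral_list_sum_map hm, lintegral_finsetSum _ fun i _ => hm' i]
  refine add_le_add (mul_le_mul_right (sum_lintegral_prefixOf_eq_le hlam hH hk l q a) _)
    (mul_le_mul_right ?_ _)
  refine (Finset.sum_le_sum fun i _ => ?_).trans
    (le_of_eq (by rw [Finset.sum_const, Finset.card_range, nsmul_eq_mul]))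
  rw [lintegral_ite_one_zero (measurableSet_overflow hH l i _ a)]
  exact hδ i

open Classical in
theorem lintegral_level_le [IsProbabilityMeasure μ] {p : Params} {H : κ → Ω → Fingerprint p}
    (hlam : 1 ≤ p.lam) (hH : IsKWiseIndependent μ k (p.lam ^ p.len) H) (hk : 2 ≤ k) (l : ℕ) (q : κ)
    {lv : List (List (κ × V))} {δ : ENNReal}
    (hδ : ∀ a ∈ lv, ∀ i,
      μ {ω | p.slack * p.B < a.countP fun x => bucketOf p l (H x.1 ω) = i} ≤ δ) :
    ∫⁻ ω, ((lv.map (itemBound p l (H q ω) fun x => H x.1 ω)).sum : ENNReal) ∂μ ≤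
      ((p.slack + 3 : ℕ) : ENNReal) * ((lv.flatten.map Prod.fst).count q + lv.flatten.length *
        ENNReal.ofReal (1 / (p.lam : ℝ) ^ p.h l + 1 / (p.lam : ℝ) ^ p.len)) +
      lv.length * (((2 * p.lam ^ l : ℕ) : ENNReal) * (((p.lam ^ l : ℕ) : ENNReal) * δ)) := by
  induction lv with
  | nil => simp
  | cons a lv ih =>
    have h1 := lintegral_itemBound_le hlam hH hk l q (hδ a (by simp))
    have h2 := ih fun a ha => hδ a (by simp [ha])
    simp only [List.map_cons, List.sum_cons, Nat.cast_add, List.flatten_cons, List.map_append,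
      List.count_append, List.length_append, List.length_cons, Nat.cast_one] at h2 ⊢
    rw [lintegral_add_left (measurable_itemBound hH l q a)]
    refine (add_le_add h1 h2).trans (le_of_eq ?_)
    push_cast
    ring

/-! ### Evaluation of the bounds and summation over the levels -/

theorem level_bound_le {p : Params} {β c : ℝ} (hβ : IsRoutingTableRatio p β) (hc : 0 < c)
    (hB : 1 ≤ p.B) (hlam : 1 ≤ p.lam) (hN : 1 ≤ p.N)
    (hcU : c * (p.N : ℝ) ^ 2 ≤ (p.lam : ℝ) ^ p.len) {l m : ℕ} (hm : m ≤ p.lam)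
    (hmN : m * (p.B * p.lam ^ l) ≤ p.N) :
    ((p.slack : ℝ) + 3) * (1 + (m * (p.B * p.lam ^ l) : ℕ) *
        (1 / (p.lam : ℝ) ^ p.h l + 1 / (p.lam : ℝ) ^ p.len)) +
      m * ((2 * p.lam ^ l : ℕ) * ((p.lam ^ l : ℕ) * (1 / (p.N : ℝ) ^ 2))) ≤
    ((p.slack : ℝ) + 3) * (1 + (p.lam / β + 1 / c)) + 2 := by
  have hl : (0 : ℝ) < p.lam := by exact_mod_cast hlam
  have hN' : (1 : ℝ) ≤ p.N := by exact_mod_cast hN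
  have hB' : (1 : ℝ) ≤ p.B := by exact_mod_cast hB
  have hβ0 := hβ.pos hlam
  have hm' : (m : ℝ) ≤ p.lam := by exact_mod_cast hm
  have hmN' : (m : ℝ) * (p.B * (p.lam : ℝ) ^ l) ≤ p.N := by exact_mod_cast hmN
  have h1 : (m : ℝ) * (p.B * (p.lam : ℝ) ^ l) * (1 / (p.lam : ℝ) ^ p.h l) ≤ p.lam / β := by
    rw [hβ l, mul_one_div, div_le_div_iff₀ (by positivity) hβ0]
    calc (m : ℝ) * (p.B * (p.lam : ℝ) ^ l) * β = m * (β * (p.B * (p.lam : ℝ) ^ l)) := by ring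
      _ ≤ _ := by gcongr
  have h2 : (m : ℝ) * (p.B * (p.lam : ℝ) ^ l) * (1 / (p.lam : ℝ) ^ p.len) ≤ 1 / c := by
    rw [mul_one_div, div_le_div_iff₀ (by positivity) hc, one_mul]
    have h5 : (p.N : ℝ) ≤ (p.N : ℝ) ^ 2 := by nlinarith
    have h6 := mul_le_mul_of_nonneg_right (hmN'.trans h5) hc.le
    linarith
  -- Overflow over `m` runs of `lam ^ l` buckets: both `m * lam ^ l` and `lam ^ l` are at most `N`,
  -- which is why a tail of `1 / N ^ 2` is enough.
  have h3 : (m : ℝ) * (2 * (p.lam : ℝ) ^ l * ((p.lam : ℝ) ^ l * (1 / (p.N : ℝ) ^ 2))) ≤ 2 := by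
    rcases Nat.eq_zero_or_pos m with rfl | hm0
    · simp
    · have hm1 : (1 : ℝ) ≤ m := by exact_mod_cast hm0
      have hx : (0 : ℝ) < (p.lam : ℝ) ^ l := by positivity
      have h7 : (m : ℝ) * (p.lam : ℝ) ^ l ≤ p.N :=
        le_trans (by gcongr; exact le_mul_of_one_le_left hx.le hB') hmN'
      have h8 : (p.lam : ℝ) ^ l ≤ p.N := le_trans (le_mul_of_one_le_left hx.le hm1) h7
      have h9 : (m : ℝ) * (p.lam : ℝ) ^ l * (p.lam : ℝ) ^ l ≤ p.N * p.N := by gcongr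
      have e : (m : ℝ) * (2 * (p.lam : ℝ) ^ l * ((p.lam : ℝ) ^ l * (1 / (p.N : ℝ) ^ 2))) =
          2 * ((m : ℝ) * (p.lam : ℝ) ^ l * (p.lam : ℝ) ^ l) / (p.N * p.N) := by
        field_simp
      rw [e, div_le_iff₀ (by positivity)]
      linarith
  push_cast
  rw [mul_add (a := (m : ℝ) * (p.B * (p.lam : ℝ) ^ l))]
  gcongr

theorem ofReal_mul_add_mul (s n m a b : ℕ) {x d : ℝ} (hx : 0 ≤ x) (hd : 0 ≤ d) :
    ENNReal.ofReal (s * (1 + n * x) + m * (a * (b * d))) =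
      s * (1 + n * ENNReal.ofReal x) + m * (a * (b * ENNReal.ofReal d)) := by
  rw [ENNReal.ofReal_add (by positivity) (by positivity), ENNReal.ofReal_mul (by positivity),
    ENNReal.ofReal_add zero_le_one (by positivity), ENNReal.ofReal_mul (by positivity),
    ENNReal.ofReal_mul (by positivity), ENNReal.ofReal_mul (by positivity),
    ENNReal.ofReal_mul (by positivity), ENNReal.ofReal_one]
  simp only [ENNReal.ofReal_natCast]

theorem lintegral_queryBound_le [IsProbabilityMeasure μ] {p : Params} {β c : ℝ}
    (hβ : IsRoutingTableRatio p β) (hc : 0 < c) (hB : 1 ≤ p.B) (hlam : 1 ≤ p.lam) (hN : 1 ≤ p.N)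
    (ha : (1 + 1 / c) * Real.exp (2 / c) + 1 ≤ p.slack) (hcB : c * Real.log p.N ≤ p.B)
    (hcU : c * (p.N : ℝ) ^ 2 ≤ (p.lam : ℝ) ^ p.len) {H : κ → Ω → Fingerprint p}
    (hH : IsKWiseIndependent μ k (p.lam ^ p.len) H) (hk : 2 ≤ k) (hck : c * Real.log p.N ≤ k)
    (l : ℕ) (q : κ) {as : List (List (List (κ × V)))} (hs : Sized p.B p.lam l as)
    (hnd : (as.flatten.flatten.map Prod.fst).Nodup) (hlen : as.flatten.flatten.length ≤ p.N) :
    ∫⁻ ω, (queryBound p (H q ω) (fun x => H x.1 ω) l as : ENNReal) ∂μ ≤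
      as.length * ENNReal.ofReal
        (1 + (((p.slack : ℝ) + 3) * (1 + (p.lam / β + 1 / c)) + 2)) := by
  classical
  have hβ0 := hβ.pos hlam
  induction as generalizing l with
  | nil => simp [queryBound]
  | cons lv rest ih =>
    obtain ⟨hs1, hs2, hs3⟩ := hs
    simp only [List.flatten_cons, List.flatten_append, List.map_append, List.length_append]
      at hnd hlen
    have h1 := ih (l + 1) hs3 hnd.of_append_right (by omega)
    have hlv := length_flatten_of_forall hs2
    have hnd' := hnd.of_append_left
    have hδ : ∀ a ∈ lv, ∀ i,
        μ {ω | p.slack * p.B < a.countP fun x => bucketOf p l (H x.1 ω) = i} ≤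
          ENNReal.ofReal (1 / (p.N : ℝ) ^ 2) := by
      intro a ham i
      have hsub : (a.map Prod.fst).Nodup :=
        hnd'.sublist ((List.sublist_flatten_of_mem ham).map _)
      have hcard : (a.map Prod.fst).toFinset.card = a.length := by
        rw [List.toFinset_card_of_nodup hsub, List.length_map]
      have hle : a.length ≤ p.N := by
        have := (List.sublist_flatten_of_mem ham).length_le
        omega
      have h := measure_bucket_overflow_le hc hB hlam hN ha hcB hcU hH hck l i
        (s := (a.map Prod.fst).toFinset) (by rw [hcard, hs2 a ham]) (by rwa [hcard])
      refine le_trans (measure_mono fun ω hω => ?_) h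
      have e := countP_eq_card_filter hsub fun y => bucketOf p l (H y ω) = i
      rw [Set.mem_ofPred_eq, ← e]
      exact hω
    have h2 := lintegral_level_le hlam hH hk l q hδ
    -- Since keys are distinct, `q` itself accounts for at most one matching item on the level.
    have h3 : ((lv.flatten.map Prod.fst).count q : ENNReal) ≤ 1 := by
      exact_mod_cast List.nodup_iff_count_le_one.1 hnd' q
    have h4 := ENNReal.ofReal_le_ofReal (level_bound_le hβ hc hB hlam hN hcU hs1.le
      (by rw [← hlv]; omega))
    have h5 : ((p.slack + 3 : ℕ) : ENNReal) * ((lv.flatten.map Prod.fst).count q +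
        lv.flatten.length *
        ENNReal.ofReal (1 / (p.lam : ℝ) ^ p.h l + 1 / (p.lam : ℝ) ^ p.len)) +
      lv.length * (((2 * p.lam ^ l : ℕ) : ENNReal) * (((p.lam ^ l : ℕ) : ENNReal) *
        ENNReal.ofReal (1 / (p.N : ℝ) ^ 2))) ≤
        ENNReal.ofReal (((p.slack : ℝ) + 3) * (1 + (p.lam / β + 1 / c)) + 2) := by
      refine le_trans ?_ h4
      rw [show (p.slack : ℝ) + 3 = ((p.slack + 3 : ℕ) : ℝ) by push_cast; rfl,
        ofReal_mul_add_mul _ _ _ _ _ (by positivity) (by positivity), ← hlv]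
      gcongr
    have hmeas : Measurable fun ω =>
        ((lv.map (itemBound p l (H q ω) fun x => H x.1 ω)).sum : ENNReal) := by
      have := measurable_list_sum_map (fun a => measurable_itemBound hH l q a) lv
      simpa [Nat.cast_list_sum, List.map_map, Function.comp_def] using this
    simp only [queryBound, Nat.cast_add, Nat.cast_one, List.length_cons]
    -- Only the current level has to be measurable, so nothing is needed for the remaining levels.
    rw [lintegral_add_left (hmeas.const_add 1), lintegral_add_left measurable_const,
      lintegral_const, measure_univ, mul_one, add_mul, one_mul, add_comm (_ * _)]
    refine add_le_add ?_ h1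
    rw [ENNReal.ofReal_add zero_le_one (by positivity), ENNReal.ofReal_one]
    exact add_le_add le_rfl (h2.trans h5)

theorem lintegral_query_le [IsProbabilityMeasure μ] {p : Params} {β c : ℝ}
    (hβ : IsRoutingTableRatio p β) (hc : 0 < c) (hB : 1 ≤ p.B) (hlam : 2 ≤ p.lam)
    (hN : p.lam ≤ p.N) (hM : 3 * p.B ≤ p.M)
    (ha : (1 + 1 / c) * Real.exp (2 / c) + 1 ≤ p.slack) (hcB : c * Real.log p.N ≤ p.B)
    (hcU : c * (p.N : ℝ) ^ 2 ≤ (p.lam : ℝ) ^ p.len) {H : κ → Ω → Fingerprint p}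
    (hH : IsKWiseIndependent μ k (p.lam ^ p.len) H) (hk : 2 ≤ k) (hck : c * Real.log p.N ≤ k)
    (q : κ) {kvs : List (κ × V)} (hnd : (kvs.map Prod.fst).Nodup) (hlen : kvs.length ≤ p.N) :
    ∫⁻ ω, ((query p (insertAll p (kvs.map fun x => (H x.1 ω, x.2))).1 (H q ω)).2 : ENNReal) ∂μ ≤
      ENNReal.ofReal (2 * (3 + ((p.slack : ℝ) + 3) * (1 + 1 / c)) *
        ((1 + p.lam / β) * Real.logb p.lam p.N)) := by
  have hβ0 := hβ.pos (by omega)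
  obtain ⟨-, h2, h3, -⟩ := insertItems_spec hB hlam kvs
  have hsub := (List.sublist_append_right (insertItems p.B p.lam kvs).1
    (insertItems p.B p.lam kvs).2.flatten.flatten)
  have h4 := lintegral_queryBound_le hβ hc hB (by omega) (by omega) ha hcB hcU hH hk hck 0 q h2
    (((h3.map Prod.fst).nodup_iff.2 hnd).sublist (hsub.map _))
    ((hsub.length_le.trans h3.length_eq.le).trans hlen)
  refine (lintegral_mono fun ω => ?_).trans (h4.trans ?_)
  · exact Nat.cast_le.2 <| query_cost_le hB hlam hM (fun x : κ × V => (H x.1 ω, x.2)) kvs (H q ω)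
  · rw [← ENNReal.ofReal_natCast, ← ENNReal.ofReal_mul (by positivity)]
    apply ENNReal.ofReal_le_ofReal
    have hg : 1 ≤ Nat.log p.lam p.N := Nat.log_pos (by omega) hN
    have hL : (Nat.log p.lam p.N : ℝ) ≤ Real.logb p.lam p.N := Real.natLog_le_logb _ _
    have h5 := length_levels_le hB hlam hlen
    have h6 : ((insertItems p.B p.lam kvs).2.length : ℝ) ≤ 2 * Real.logb p.lam p.N := by
      have : ((insertItems p.B p.lam kvs).2.length : ℝ) ≤ 2 * Nat.log p.lam p.N := by
        exact_mod_cast (by omega : (insertItems p.B p.lam kvs).2.length ≤ 2 * Nat.log p.lam p.N)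
      linarith
    have h7 : 1 + (((p.slack : ℝ) + 3) * (1 + (p.lam / β + 1 / c)) + 2) ≤
        (3 + ((p.slack : ℝ) + 3) * (1 + 1 / c)) * (1 + p.lam / β) := by
      have h8 : 0 ≤ (p.lam : ℝ) / β := by positivity
      have h9 : 0 ≤ ((p.slack : ℝ) + 3) * (1 / c) * (p.lam / β) := by positivity
      linarith
    calc _ ≤ 2 * Real.logb p.lam p.N *
          ((3 + ((p.slack : ℝ) + 3) * (1 + 1 / c)) * (1 + p.lam / β)) :=
        mul_le_mul h6 h7 (by positivity) ((Nat.cast_nonneg _).trans h6)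
      _ = _ := by ring

end BOA

/-- `c` is the implied constant of the standing assumptions `B = Ω(log N)`, `Θ(log N)`-wise
independence, and a universe of fingerprints of size `Ω(N ^ 2)`. -/
theorem mainTheorem8 (c : ℝ) (hc : 0 < c) :
    ∃ (a : ℕ) (C : ℝ), 0 < C ∧
      ∀ (p : BOA.Params) (β : ℝ),
        p.slack = a → BOA.IsRoutingTableRatio p β →
        2 ≤ p.lam → p.lam ≤ p.N → 3 * p.B ≤ p.M →
        c * Real.log p.N ≤ p.B → c * (p.N : ℝ) ^ 2 ≤ (p.lam : ℝ) ^ p.len →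
        -- amortized insertion cost
        (∀ (V : Type*) (xs : List (BOA.Fingerprint p × V)), xs.length ≤ p.N →
          ((BOA.insertAll p xs).2 : ℝ) ≤
            xs.length * (C * ((1 / p.B) *
              (β + Real.logb (p.M / p.B) p.N + Real.logb p.lam p.N)))) ∧
        -- expected query cost, for stored keys and for others
        (∀ (κ V Ω : Type*) [MeasurableSpace Ω] (μ : MeasureTheory.Measure Ω)
            [MeasureTheory.IsProbabilityMeasure μ] (k : ℕ) (H : κ → Ω → BOA.Fingerprint p),
          2 ≤ k → c * Real.log p.N ≤ k → BOA.IsKWiseIndependent μ k (p.lam ^ p.len) H →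
          ∀ (kvs : List (κ × V)) (q : κ), (kvs.map Prod.fst).Nodup → kvs.length ≤ p.N →
            ∫⁻ ω, ((BOA.query p (BOA.insertAll p (kvs.map fun x => (H x.1 ω, x.2))).1
                (H q ω)).2 : ENNReal) ∂μ ≤
              ENNReal.ofReal (C * ((1 + p.lam / β) * Real.logb p.lam p.N))) := by
  -- The least natural number that meets the requirement of `tail_ratio_le`.
  set a : ℕ := ⌈(1 + 1 / c) * Real.exp (2 / c) + 1⌉₊ with ha
  set C₁ : ℝ := 14 + 8 * (a + 3) with hC₁
  set C₂ : ℝ := 2 * (3 + ((a : ℝ) + 3) * (1 + 1 / c)) with hC₂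
  have hC₁0 : 0 < C₁ := by positivity
  have hC₂0 : 0 < C₂ := by positivity
  refine ⟨a, C₁ + C₂, by positivity, fun p β hslack hβ hlam hN hM hcB hcU => ?_⟩
  have hlogN : 0 < Real.log p.N := Real.log_pos (by exact_mod_cast (by omega : 1 < p.N))
  -- A nonempty block is not assumed: it follows from `c * log N ≤ B`, as `2 ≤ N`.
  have hB' : (0 : ℝ) < p.B := lt_of_lt_of_le (by positivity) hcB
  have hB : 1 ≤ p.B := by exact_mod_cast hB'
  have hβ0 := hβ.pos (by omega)
  have hL : 0 ≤ Real.logb p.lam p.N := Real.logb_nonneg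
    (by exact_mod_cast (by omega : 1 < p.lam)) (by exact_mod_cast (by omega : 1 ≤ p.N))
  have hLM : 0 ≤ Real.logb (p.M / p.B) p.N := by
    refine Real.logb_nonneg ?_ (by exact_mod_cast (by omega : 1 ≤ p.N))
    rw [lt_div_iff₀ hB', one_mul]
    exact_mod_cast (by omega : p.B < p.M)
  constructor
  · intro V xs hxs
    have h := BOA.insertAll_cost hβ hB hlam hN hM hxs
    rw [hslack, ← hC₁, mul_comm, ← le_div_iff₀ hB'] at h
    refine h.trans ?_
    rw [mul_div_assoc, mul_div_assoc, div_eq_inv_mul, ← one_div]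
    gcongr
    linarith
  · intro κ V Ω _ μ _ k H hk hck hH kvs q hnd hlen
    have h := BOA.lintegral_query_le hβ hc hB hlam hN hM
      (by rw [hslack]; exact Nat.le_ceil _) hcB hcU hH hk hck q hnd hlen
    rw [hslack, ← hC₂] at h
    refine h.trans (ENNReal.ofReal_le_ofReal ?_)
    gcongr
    linarith
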